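/- Let $S$ be a finite set of primes (so $\infty\notin S$), let $d\ge 1$, $m\ge 0$ be integers and $n=d+m$. Write $\mathbb{Q}_S^k=\prod_{\nu\in S}\mathbb{Q}_\nu^k$ and $\mathbb{Z}_S^k=\prod_{\nu\in S}\mathbb{Z}_\nu^k$, and let $\mu_{S,d}$ be the Haar measure on $\mathbb{Q}_S^d$ with $\mu_{S,d}(\mathbb{Z}_S^d)=1$. For each $\nu\in S$ let $\mathcal{U}_\nu\subseteq\mathbb{Z}_\nu^d$ be open and let $\mathbf{f}_\nu:\mathcal{U}_\nu\to\mathbb{Z}_\nu^m$ be a $C^2$ map (in the sense of non-archimedean calculus: the iterated difference quotients of $\mathbf{f}_\nu$ up to order two extend continuously to the diagonal). For $T\subseteq S$ put $\mathcal{U}_T=\prod_{\nu\in T}\mathcal{U}_\nu$, $\mathbf{F}_T(\mathbf{x})=(\mathbf{x}_\nu,\mathbf{f}_\nu(\mathbf{x}_\nu))_{\nu\in T}$ and $\mathcal{M}_\nu=\{(\mathbf{x}_\nu,\mathbf{f}_\nu(\mathbf{x}_\nu)):\mathbf{x}_\nu\in\mathcal{U}_\nu\}$, so that $\mathbf{F}_T$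 parametrises $\prod_{\nu\in T}\mathcal{M}_\nu$; put $\mathcal{U}=\mathcal{U}_S$, $\mathbf{F}=\mathbf{F}_S$. For positive reals $\boldsymbol{\tau}=(\tau_{i,\nu})_{1\le i\le n,\,\nu\in S}$ and $c>0$ let $W(c;\boldsymbol\tau)$ be the set of $\mathbf{y}\in\mathbb{Z}_S^n$ such that $$|b_0y_{i,\nu}-b_i|_\nu<c\,\|\mathbf{b}\|_\infty^{-\tau_{i,\nu}}\qquad(1\le i\le n,\ \nu\in S)$$ for infinitely many $\mathbf{b}=(b_0,\dots,b_n)\in\mathbb{Z}^{n+1}$, where $\|\mathbf{b}\|_\infty=\max_{0\le i\le n}|b_i|$, and let $\mathbf{Bad}^{(S)}_n(\boldsymbol\tau)=\mathbb{Z}_S^n\setminus\bigcap_{\ell\ge1}W(1/\ell;\boldsymbol\tau)$. For $T\subseteq S$ and positive weights $\boldsymbol{\rho}=(\rho_{i,\nu})_{1\le i\le n,\,\nu\in T}$ with $\sum_{i=1}^n\sum_{\nu\in T}\rho_{i,\nu}=n+1$, let, for $\mathbf{y}\in\mathbb{Q}_T^n$, $$\omega_{\boldsymbol\rho}(\mathbf{y})=\sup\Big\{\omega\in\mathbb{R}:\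 \max_{i,\nu}|b_0y_{i,\nu}+b_i|_\nu^{1/\rho_{i,\nu}}\le\|\mathbf{b}\|_\infty^{-\omega}\text{ for infinitely many }\mathbf{b}\in\mathbb{Z}^{n+1}\Big\},$$ and let the Diophantine exponent of $\prod_{\nu\in T}\mathcal{M}_\nu$ be the essential supremum $$\omega_{\boldsymbol\rho}\Big(\prod_{\nu\in T}\mathcal{M}_\nu\Big)=\inf\big\{\omega:\ \omega_{\boldsymbol\rho}(\mathbf{F}_T(\mathbf{x}))\le\omega\text{ for }\mu_{T,d}\text{-almost every }\mathbf{x}\in\mathcal{U}_T\big\}\in[-\infty,+\infty].$$ The manifold $\prod_{\nu\in T}\mathcal{M}_\nu$ is called strongly extremal if this exponent equals $1$ for all positive weights $\boldsymbol\rho$ with $\sum_{i}\sum_{\nu\in T}\rho_{i,\nu}=n+1$ and $\sum_{\nu\in T}\rho_{i,\nu}>1$ for each $1\le i\le n$. **Theorem.** Let $\boldsymbol\tau=(\tau_{i,\nu})_{1\le i\le n,\,\nu\in S}$ be positive reals satisfying $$\sum_{i=1}^n\sum_{\nu\in S}\tau_{i,\nu}=n+1,\qquad \min_{1\le i\le d}\tau_{i,\nu}\ge\max_{1\le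 j\le m}\tau_{d+j,\nu}\ (\nu\in S),\qquad \frac1{n+1}\sum_{i=1}^n\tau_{i,\nu}<\tau_{j,\nu}\ (1\le j\le n,\ \nu\in S).$$ For $\nu\in S$ define weights $\boldsymbol\tau^\nu$ over $S\setminus\{\nu\}$ by $\tau^\nu_{i,\sigma}=\tau_{i,\sigma}\Big/\Big(1-\frac1{n+1}\sum_{k=1}^n\tau_{k,\nu}\Big)$. (1) Suppose that for every $\nu\in S$ with $\min_{1\le i\le n}\tau_{i,\nu}\le1$ we have $$\omega_{\boldsymbol\tau^\nu}\Big(\prod_{\sigma\in S\setminus\{\nu\}}\mathcal{M}_\sigma\Big)<\frac{1-\frac1{n+1}\sum_{i=1}^n\tau_{i,\nu}}{1-\min_{1\le i\le n}\tau_{i,\nu}},$$ where the right-hand side is read as $+\infty$ if $\min_i\tau_{i,\nu}=1$. Then $\mu_{S,d}\big(\mathbf{F}^{-1}(\mathbf{Bad}^{(S)}_n(\boldsymbol\tau))\big)=0$. (2) Suppose that for every $\nu\in S$ with $\min_{1\le i\le n}\tau_{i,\nu}\le1$ the manifold $\prod_{\sigma\in S\setminus\{\nu\}}\mathcal{M}_\sigma$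 is strongly extremal. Then $\mu_{S,d}\big(\mathbf{F}^{-1}(\mathbf{Bad}^{(S)}_n(\boldsymbol\tau))\big)=0$. -/

import Mathlib

open MeasureTheory

noncomputable section

namespace SArith

instance instFactPrime (ν : Nat.Primes) : Fact (ν : ℕ).Prime := ⟨ν.2⟩

instance instMeasurableSpacePadic (ν : Nat.Primes) : MeasurableSpace ℚ_[(ν : ℕ)] := borel _

instance instBorelSpacePadic (ν : Nat.Primes) : BorelSpace ℚ_[(ν : ℕ)] := ⟨rfl⟩

/-! ### `C²` maps over a valued field

Over a non-archimedean field the mere existence and continuity of derivatives is too weak (it does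
not give a Taylor formula); the standard notion asks that the iterated difference quotients extend
continuously to the diagonal. -/

section Calculus

variable (K : Type*) {E F : Type*} [Field K] [TopologicalSpace K]
  [AddCommGroup E] [Module K E] [TopologicalSpace E]
  [AddCommGroup F] [Module K F] [TopologicalSpace F]

/-- The domain `{(x, v, t) : x ∈ U, x + t v ∈ U}` of the extended difference quotient. -/
def diffQuotDomain (U : Set E) : Set (E × E × K) :=
  {z | z.1 ∈ U ∧ z.1 + z.2.2 • z.2.1 ∈ U}

/-- `g` is a continuous extension, to all `(x, v, t)` including `t = 0`, of the difference quotient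
`(f (x + t v) - f x) / t`. -/
def IsDiffQuot (f : E → F) (U : Set E) (g : E × E × K → F) : Prop :=
  ContinuousOn g (diffQuotDomain K U) ∧
    ∀ x v t, (x, v, t) ∈ diffQuotDomain K U → f (x + t • v) - f x = t • g (x, v, t)

/-- `f` is `C¹` on the open set `U`: its difference quotient extends continuously. -/
def IsC1On (f : E → F) (U : Set E) : Prop :=
  ∃ g : E × E × K → F, IsDiffQuot K f U g

/-- `f` is `C²` on the open set `U`: its difference quotient extends to a `C¹` map. -/
def IsC2On (f : E → F) (U : Set E) : Prop :=
  ∃ g : E × E × K → F, IsDiffQuot K f U g ∧ IsC1On K g (diffQuotDomain K U)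

end Calculus

/-! ### The `S`-arithmetic space and its Haar measure, `∞ ∉ S` -/

/-- `ℚ_S^n`, the product over `ν ∈ S` of `ℚ_ν^n`. -/
abbrev QS (S : Finset Nat.Primes) (n : ℕ) : Type := ∀ ν : S, Fin n → ℚ_[(ν.1 : ℕ)]

/-- The closed unit ball `ℤ_ν` of `ℚ_ν`. -/
def unitBall (ν : Nat.Primes) : TopologicalSpace.PositiveCompacts ℚ_[(ν : ℕ)] where
  carrier := Metric.closedBall 0 1
  isCompact' := isCompact_closedBall 0 1
  interior_nonempty' :=
    ⟨0, interior_mono Metric.ball_subset_closedBall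
      (by rw [Metric.isOpen_ball.interior_eq]; exact Metric.mem_ball_self one_pos)⟩

/-- The Haar measure `μ_{S,d}` on `ℚ_S^d` giving mass `1` to `ℤ_S^d`. -/
def haar (S : Finset Nat.Primes) (d : ℕ) : Measure (QS S d) :=
  Measure.pi fun ν : S => Measure.pi fun _ : Fin d => Measure.addHaarMeasure (unitBall ν.1)

/-- `ℤ_S^n`. -/
def ZS (S : Finset Nat.Primes) (n : ℕ) : Set (QS S n) := {y | ∀ ν i, ‖y ν i‖ ≤ 1}

/-! ### Badly approximable points -/

/-- Points `y ∈ ℤ_S^n` with `|b₀ y_{i,ν} - b_i|_ν < c ‖b‖_∞ ^ (-τ_{i,ν})` for all `i`, `ν`, for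
infinitely many integer vectors `b = (b₀, …, b_n)`; `‖b‖` is the maximum norm. -/
def W (S : Finset Nat.Primes) {n : ℕ} (τ : Nat.Primes → Fin n → ℝ) (c : ℝ) : Set (QS S n) :=
  {y | y ∈ ZS S n ∧ {b : Fin (n + 1) → ℤ | ∀ (ν : S) (i : Fin n),
    ‖(b 0 : ℚ_[(ν.1 : ℕ)]) * y ν i - (b i.succ : ℚ_[(ν.1 : ℕ)])‖ <
      c * ‖b‖ ^ (-τ ν.1 i)}.Infinite}

/-- The `τ`-badly approximable points `Bad_n^{(S)}(τ) = ℤ_S^n \ ⋂_{ℓ ≥ 1} W(1/ℓ, τ)`. -/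
def Bad (S : Finset Nat.Primes) {n : ℕ} (τ : Nat.Primes → Fin n → ℝ) : Set (QS S n) :=
  ZS S n \ ⋂ ℓ : ℕ, W S τ (1 / ((ℓ : ℝ) + 1))

/-! ### Weights -/

/-- Positivity of the weights, and the normalisation `∑_i ∑_{ν ∈ S} τ_{i,ν} = n + 1`. -/
def IsWeight (S : Finset Nat.Primes) {n : ℕ} (τ : Nat.Primes → Fin n → ℝ) : Prop :=
  (∀ ν ∈ S, ∀ i, 0 < τ ν i) ∧ ∑ i, ∑ ν ∈ S, τ ν i = (n : ℝ) + 1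

/-- The rescaled weights `τ^ν_{i,σ} = τ_{i,σ} / (1 - (∑_i τ_{i,ν}) / (n + 1))`. -/
def rescale {n : ℕ} (τ : Nat.Primes → Fin n → ℝ) (ν : Nat.Primes) : Nat.Primes → Fin n → ℝ :=
  fun σ i => τ σ i / (1 - (∑ k, τ ν k) / ((n : ℝ) + 1))

/-! ### Diophantine exponents -/

/-- `ω_τ(y)`: the supremum of the real `ω` such that
`max_{i,ν} |b₀ y_{i,ν} + b_i|_ν ^ (1/τ_{i,ν}) ≤ ‖b‖_∞ ^ (-ω)` for infinitely many integer
vectors `b`. -/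
def exponent (S : Finset Nat.Primes) {n : ℕ} (τ : Nat.Primes → Fin n → ℝ) (y : QS S n) : EReal :=
  ⨆ ω ∈ {ω : ℝ | {b : Fin (n + 1) → ℤ | ∀ (ν : S) (i : Fin n),
    ‖(b 0 : ℚ_[(ν.1 : ℕ)]) * y ν i + (b i.succ : ℚ_[(ν.1 : ℕ)])‖ ^ (1 / τ ν.1 i) ≤
      ‖b‖ ^ (-ω)}.Infinite}, (ω : EReal)

/-- `𝒰 = ∏_{ν ∈ S} 𝒰_ν`. -/
def domain (S : Finset Nat.Primes) {d : ℕ}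
    (U : ∀ ν : Nat.Primes, Set (Fin d → ℚ_[(ν : ℕ)])) : Set (QS S d) :=
  {x | ∀ ν : S, x ν ∈ U ν.1}

/-- The parametrisation `F(x) = (x_ν, f_ν(x_ν))_{ν ∈ S}` of `∏_{ν ∈ S} M_ν`. -/
def param (S : Finset Nat.Primes) {d m : ℕ}
    (f : ∀ ν : Nat.Primes, (Fin d → ℚ_[(ν : ℕ)]) → (Fin m → ℚ_[(ν : ℕ)])) (x : QS S d) :
    QS S (d + m) :=
  fun ν => Fin.append (x ν) (f ν.1 (x ν))

/-- The Diophantine exponent of `∏_{ν ∈ S} M_ν`: the essential supremum of `ω_τ(F(x))`, that is the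
infimum of all `ω` with `ω_τ(F(x)) ≤ ω` for almost every `x ∈ 𝒰`. -/
def manifoldExponent (S : Finset Nat.Primes) {d m : ℕ}
    (U : ∀ ν : Nat.Primes, Set (Fin d → ℚ_[(ν : ℕ)]))
    (f : ∀ ν : Nat.Primes, (Fin d → ℚ_[(ν : ℕ)]) → (Fin m → ℚ_[(ν : ℕ)]))
    (τ : Nat.Primes → Fin (d + m) → ℝ) : EReal :=
  sInf {ω : EReal | ∀ᵐ x ∂(haar S d), x ∈ domain S U → exponent S τ (param S f x) ≤ ω}

/-- `∏_{ν ∈ S} M_ν` is strongly extremal: its exponent is `1` for all admissible weights, i.e. all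
positive normalised weights with `∑_{ν ∈ S} τ_{i,ν} > 1` for every `i`. -/
def StronglyExtremal (S : Finset Nat.Primes) {d m : ℕ}
    (U : ∀ ν : Nat.Primes, Set (Fin d → ℚ_[(ν : ℕ)]))
    (f : ∀ ν : Nat.Primes, (Fin d → ℚ_[(ν : ℕ)]) → (Fin m → ℚ_[(ν : ℕ)])) : Prop :=
  ∀ τ : Nat.Primes → Fin (d + m) → ℝ, IsWeight S τ → (∀ i, 1 < ∑ ν ∈ S, τ ν i) →
    manifoldExponent S U f τ = 1

/-- The bound `(1 - (∑_i τ_{i,ν}) / (n + 1)) / (1 - min_i τ_{i,ν})`, read as `+∞` when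
`min_i τ_{i,ν} = 1`. It is only used when `min_i τ_{i,ν} ≤ 1`. -/
def exponentBound {n : ℕ} (τ : Nat.Primes → Fin n → ℝ) (ν : Nat.Primes) : EReal :=
  if (⨅ i, τ ν i) < 1 then
    (((1 - (∑ i, τ ν i) / ((n : ℝ) + 1)) / (1 - ⨅ i, τ ν i) : ℝ) : EReal)
  else ⊤

end SArith

end

namespace SArith

noncomputable section

open Filter Topology Metric

/-! ### Haar measure on `ℚ_p` is doubling, and scaling of limsup sets -/

/-! Fix ε > 0; it is enough that F(x) ∈ W(ε) for almost every x. Replace the last m forms b₀f_j(x) -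
b_{d+j} by their tangential corrections b₀f_j(x) - b_{d+j} - ∑ D_{ji}(b₀x_i - b_i). Pigeonhole
(`exists_int_vec_forms_le`) gives, for every large H, a nonzero b of height at most H with the first
d forms at most C·H^(-τ) and the corrected forms at most η·H^(-τ). Here η is as small as desired, at
the price of a large C.

So x lies in a box about (b_i/b₀) with sides C·H^(-τ)/|b₀|. If C is replaced by η, every point y of
the smaller box has F(y) approximated by b with constant ε (`norm_graph_form_lt`): the linear part
is controlled because the first d weights dominate, and the quadratic Taylor error is absorbed once
|b₀|_ν is a large multiple of H^(-min τ). Almost every point in infinitely many large boxes is also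
in infinitely many small ones, by Lebesgue density in one coordinate at a time
(`ae_mem_limsupBox_shrink`).

The exponent condition serves only to bound |b₀|_ν from below (`le_norm_leading_coeff`). If |b₀|_ν
is too small, all of b is divisible by a high power of the prime ν. Dividing it out leaves the
errors at the other primes unchanged and lowers the height to about H^(1 - min τ). This is absurd if
min τ > 1, and otherwise contradicts the exponent bound at almost every point.

Part (2) follows from part (1): the rescaled weights are admissible, so the exponent is 1, while the
required bound exceeds 1. -/

theorem closedBall_two_mul_subset (p : ℕ) [Fact p.Prime] (x : ℚ_[p]) {ε : ℝ} (hε : 0 < ε) :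
    ∃ c : ℕ → ℚ_[p], closedBall x (2 * ε) ⊆ ⋃ n ∈ Finset.range (p ^ 2), closedBall (c n) ε := by
  have hp : (1 : ℝ) < p := by exact_mod_cast (Fact.out : p.Prime).one_lt
  have hp2 : (2 : ℝ) ≤ p := by exact_mod_cast (Fact.out : p.Prime).two_le
  have hp0 : (0 : ℝ) < p := by linarith
  obtain ⟨k, hk1, hk2⟩ := exists_mem_Ico_zpow hε hp
  have hpp : (p : ℚ_[p]) ≠ 0 := by exact_mod_cast (Fact.out : p.Prime).ne_zero
  -- Since 2ε ≤ p · p^(k+1), the large ball lies in the ball of radius p^(k+2). Its first two p-adic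
  -- digits cut that ball into p² balls of radius p^k ≤ ε.
  refine ⟨fun n => x + n * (p : ℚ_[p]) ^ (-(k + 2)), fun y hy => ?_⟩
  have hy' : ‖y - x‖ ≤ (p : ℝ) ^ (k + 2) := by
    rw [mem_closedBall, dist_eq_norm] at hy
    refine hy.trans ?_
    rw [show k + 2 = (k + 1) + 1 by ring, zpow_add_one₀ hp0.ne', mul_comm]
    gcongr
  have hz : ‖(y - x) * (p : ℚ_[p]) ^ (k + 2)‖ ≤ 1 := by
    rw [norm_mul, Padic.norm_p_zpow]
    calc _ ≤ (p : ℝ) ^ (k + 2) * (p : ℝ) ^ (-(k + 2)) := by gcongr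
      _ = 1 := by rw [← zpow_add₀ hp0.ne']; simp
  let z : ℤ_[p] := ⟨_, hz⟩
  have hn := (PadicInt.norm_le_pow_iff_mem_span_pow _ _).mpr (PadicInt.appr_spec 2 z)
  simp only [Set.mem_iUnion, Finset.mem_range]
  refine ⟨z.appr 2, z.appr_lt 2, ?_⟩
  rw [mem_closedBall, dist_eq_norm]
  refine le_trans ?_ hk1
  have e : y - (x + (z.appr 2 : ℚ_[p]) * (p : ℚ_[p]) ^ (-(k + 2))) =
      ((z - z.appr 2 : ℤ_[p]) : ℚ_[p]) * (p : ℚ_[p]) ^ (-(k + 2)) := by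
    push_cast
    rw [sub_mul, show (z : ℚ_[p]) = (y - x) * (p : ℚ_[p]) ^ (k + 2) from rfl, mul_assoc,
      ← zpow_add₀ hpp]
    simp only [add_neg_cancel, zpow_zero]
    ring
  rw [e, norm_mul, Padic.norm_p_zpow]
  calc _ ≤ (p : ℝ) ^ (-(2 : ℕ) : ℤ) * (p : ℝ) ^ (-(-(k + 2))) := by
        gcongr
        exact hn
    _ = (p : ℝ) ^ k := by rw [← zpow_add₀ hp0.ne']; congr 1; push_cast; ring

/-- By translation invariance each of the p² covering balls has the measure of the original one.
Doubling is what the density theorem requires. -/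
instance isUnifLocDoublingMeasure_addHaar (ν : Nat.Primes) :
    IsUnifLocDoublingMeasure (Measure.addHaarMeasure (unitBall ν)) where
  exists_measure_closedBall_le_mul'' := by
    refine ⟨(((ν : ℕ) ^ 2 : ℕ) : NNReal), ?_⟩
    filter_upwards [self_mem_nhdsWithin] with ε hε x
    obtain ⟨c, hc⟩ := closedBall_two_mul_subset (ν : ℕ) x hε
    refine (measure_mono hc).trans ((measure_biUnion_finset_le _ _).trans ?_)
    have : ∀ n, Measure.addHaarMeasure (unitBall ν) (closedBall (c n) ε) =
        Measure.addHaarMeasure (unitBall ν) (closedBall x ε) := fun n => by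
      rw [Measure.addHaar_closedBall_center, ← Measure.addHaar_closedBall_center _ x]
    simp [this]

/-- Shrinking the balls of a limsup set by a constant factor changes it by a null set only. -/
theorem ae_limsup_closedBall_shrink {α : Type*} [PseudoMetricSpace α] [MeasurableSpace α]
    [SecondCountableTopology α] [BorelSpace α] (μ : Measure α) [IsUnifLocDoublingMeasure μ]
    [IsLocallyFiniteMeasure μ] {ι : Type*} [Countable ι] (I : ℕ → Set ι) (hI : Antitone I)
    (w : ι → α) (r : ι → ℝ) (A : ℝ) (δ : ℕ → ℝ) (hδ : Tendsto δ atTop (𝓝 0))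
    (hr : ∀ K, ∀ k ∈ I K, 0 < r k ∧ r k ≤ δ K) :
    ∀ᵐ s ∂μ, (∀ K, ∃ k ∈ I K, s ∈ closedBall (w k) (A * r k)) →
      ∀ K, ∃ k ∈ I K, s ∈ closedBall (w k) (r k) := by
  -- Points of `Z N` avoid every small ball of the family `I N`. At a density point, `Z N` would
  -- nearly fill the small balls whose `A`-fold dilates contain the point, yet it misses them all
  -- once `K ≥ N`. The density theorem allows the point to be off-centre by the factor `A`.
  let Z : ℕ → Set α := fun N => {s | ∀ k ∈ I N, s ∉ closedBall (w k) (r k)}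
  have hZm : ∀ N, MeasurableSet (Z N) := by
    intro N
    have : Z N = ⋂ k ∈ I N, (closedBall (w k) (r k))ᶜ := by ext; simp [Z]
    rw [this]
    exact MeasurableSet.biInter (Set.to_countable _) fun k _ => measurableSet_closedBall.compl
  have key : ∀ N, ∀ᵐ s ∂μ, s ∈ Z N →
      ¬ (∀ K, ∃ k ∈ I K, s ∈ closedBall (w k) (A * r k)) := by
    intro N
    rw [← ae_restrict_iff' (hZm N)]
    filter_upwards [IsUnifLocDoublingMeasure.ae_tendsto_measure_inter_div μ (Z N) A] with s hs h
    choose k hk hks using h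
    have hlim : Tendsto (fun K => r (k K)) atTop (𝓝[>] 0) := by
      refine tendsto_nhdsWithin_iff.2 ⟨?_, Eventually.of_forall fun K => (hr K _ (hk K)).1⟩
      exact squeeze_zero (fun K => (hr K _ (hk K)).1.le) (fun K => (hr K _ (hk K)).2) hδ
    have h1 := hs (fun K => w (k K)) (fun K => r (k K)) hlim (Eventually.of_forall hks)
    have h0 : ∀ᶠ K in atTop, μ (Z N ∩ closedBall (w (k K)) (r (k K))) /
        μ (closedBall (w (k K)) (r (k K))) = 0 := by
      filter_upwards [eventually_ge_atTop N] with K hK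
      have : Z N ∩ closedBall (w (k K)) (r (k K)) = ∅ := by
        ext t
        simp only [Set.mem_inter_iff, Set.mem_empty_iff_false, iff_false, not_and]
        exact fun ht => ht _ (hI hK (hk K))
      simp [this]
    have := tendsto_nhds_unique (tendsto_const_nhds.congr' (h0.mono fun _ h => h.symm)) h1
    exact zero_ne_one this
  filter_upwards [ae_all_iff.2 key] with s hs h K
  by_contra hc
  push Not at hc
  exact hs K hc h

/-- Tonelli, integrating the indicator over the single coordinate `i` first. -/
theorem pi_null_of_slices {ι : Type*} [Fintype ι] [DecidableEq ι] {X : ι → Type*}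
    [∀ i, MeasurableSpace (X i)] (μ : ∀ i, Measure (X i)) [∀ i, SigmaFinite (μ i)] (i : ι)
    {E : Set (∀ i, X i)} (hE : MeasurableSet E)
    (h : ∀ x : ∀ i, X i, μ i {t | Function.update x i t ∈ E} = 0) : Measure.pi μ E = 0 := by
  have hm : Measurable (E.indicator (1 : (∀ i, X i) → ENNReal)) := measurable_one.indicator hE
  rw [← lintegral_indicator_one hE]
  have : ∫⁻ a, E.indicator 1 a ∂Measure.pi μ = ∫⁻ a, (0 : ENNReal) ∂Measure.pi μ := by
    refine lintegral_eq_of_lmarginal_eq {i} hm measurable_const ?_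
    funext x
    rw [lmarginal_singleton, lmarginal_singleton]
    have e : ∀ t, E.indicator (1 : (∀ i, X i) → ENNReal) (Function.update x i t) =
        (Function.update x i ⁻¹' E).indicator 1 t := fun t => rfl
    simp only [e]
    rw [lintegral_indicator_one (measurable_update x hE)]
    rw [lintegral_zero]
    exact h x
  rw [this, lintegral_zero]

/-! ### Limsup sets of boxes -/

/-- The points lying, for every `K`, in one of the boxes of the family `I K`. -/
def limsupBox {S : Finset Nat.Primes} {d : ℕ} {ι : Type*} (I : ℕ → Set ι) (w : ι → QS S d)
    (r : ι → S → Fin d → ℝ) : Set (QS S d) :=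
  {x | ∀ K, ∃ k ∈ I K, ∀ ν i, ‖x ν i - w k ν i‖ ≤ r k ν i}

theorem measurableSet_limsupBox {S : Finset Nat.Primes} {d : ℕ} {ι : Type*} [Countable ι]
    (I : ℕ → Set ι) (w : ι → QS S d) (r : ι → S → Fin d → ℝ) :
    MeasurableSet (limsupBox I w r) := by
  have : limsupBox I w r =
      ⋂ K, ⋃ k ∈ I K, ⋂ ν, ⋂ i, {x : QS S d | ‖x ν i - w k ν i‖ ≤ r k ν i} := by
    ext; simp [limsupBox]
  rw [this]
  refine MeasurableSet.iInter fun K => MeasurableSet.biUnion (Set.to_countable _) fun k _ =>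
    MeasurableSet.iInter fun ν => MeasurableSet.iInter fun i => ?_
  have hc : Continuous fun x : QS S d => ‖x ν i - w k ν i‖ := by fun_prop
  exact (isClosed_le hc continuous_const).measurableSet

/-- Shrinking one side of the boxes of a limsup set by a constant factor changes it by a null set
only. -/
theorem haar_limsupBox_diff_eq_zero {S : Finset Nat.Primes} {d : ℕ} {ι : Type*} [Countable ι]
    (I : ℕ → Set ι) (hI : Antitone I) (w : ι → QS S d) (R r : ι → S → Fin d → ℝ) (A : ℝ)
    (δ : ℕ → ℝ) (hδ : Tendsto δ atTop (𝓝 0)) (ν : S) (i : Fin d)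
    (hr : ∀ K, ∀ k ∈ I K, 0 < r k ν i ∧ r k ν i ≤ δ K)
    (hRr : ∀ k, R k ν i = A * r k ν i) (hne : ∀ k σ j, (σ, j) ≠ (ν, i) → R k σ j = r k σ j) :
    haar S d (limsupBox I w R \ limsupBox I w r) = 0 := by
  have hm : MeasurableSet (limsupBox I w R \ limsupBox I w r) :=
    (measurableSet_limsupBox _ _ _).diff (measurableSet_limsupBox _ _ _)
  refine pi_null_of_slices _ ν hm fun x => ?_
  refine pi_null_of_slices _ i (measurable_update x hm) fun t => ?_
  -- With the other coordinates frozen, only the boxes whose other sides contain the frozen point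
  -- matter. Along the remaining coordinate they are balls.
  let I' : ℕ → Set ι := fun K => {k | k ∈ I K ∧ ∀ σ j, (σ, j) ≠ (ν, i) →
    ‖Function.update x ν t σ j - w k σ j‖ ≤ r k σ j}
  have hI' : Antitone I' := fun a b hab k hk => ⟨hI hab hk.1, hk.2⟩
  have key := ae_limsup_closedBall_shrink (Measure.addHaarMeasure (unitBall ν.1)) I' hI'
    (fun k => w k ν i) (fun k => r k ν i) A δ hδ (fun K k hk => hr K k hk.1)
  have hother : ∀ s σ j, (σ, j) ≠ (ν, i) →
      Function.update x ν (Function.update t i s) σ j = Function.update x ν t σ j := by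
    intro s σ j hσ
    by_cases h : σ = ν
    · subst h
      have : j ≠ i := fun h => hσ (by rw [h])
      simp [this]
    · simp [Function.update_of_ne h]
  have hsame : ∀ s, Function.update x ν (Function.update t i s) ν i = s := by simp
  refine measure_mono_null (fun s hs => ?_) (ae_iff.1 key)
  refine fun hcon => hs.2 ?_
  have h2 := hcon fun K => ?_
  · intro K
    obtain ⟨k, hk, hks⟩ := h2 K
    refine ⟨k, hk.1, fun σ j => ?_⟩
    by_cases h : (σ, j) = (ν, i)
    · obtain ⟨rfl, rfl⟩ := Prod.mk.inj h
      rw [hsame]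
      simpa [dist_eq_norm] using hks
    · rw [hother _ _ _ h]
      exact hk.2 _ _ h
  · obtain ⟨k, hk, hks⟩ := hs.1 K
    refine ⟨k, ⟨hk, fun σ j h => ?_⟩, ?_⟩
    · rw [← hother s _ _ h, ← hne _ _ _ h]
      exact hks σ j
    · have := hks ν i
      rw [hsame, hRr] at this
      rwa [mem_closedBall, dist_eq_norm]

/-- Shrinking the boxes of a limsup set by a constant factor changes it by a null set only. -/
theorem ae_mem_limsupBox_shrink {S : Finset Nat.Primes} {d : ℕ} {ι : Type*} [Countable ι]
    (I : ℕ → Set ι) (hI : Antitone I) (w : ι → QS S d) (r : ι → S → Fin d → ℝ) (A : ℝ)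
    (δ : ℕ → ℝ) (hδ : Tendsto δ atTop (𝓝 0))
    (hr : ∀ K, ∀ k ∈ I K, ∀ ν i, 0 < r k ν i ∧ r k ν i ≤ δ K) :
    ∀ᵐ x ∂haar S d, x ∈ limsupBox I w (fun k ν i => A * r k ν i) → x ∈ limsupBox I w r := by
  classical
  -- `B` records the sides already shrunk. Treating one side at a time avoids a density theorem for
  -- boxes of unbounded eccentricity.
  have step : ∀ B : Finset (S × Fin d), ∀ᵐ x ∂haar S d,
      x ∈ limsupBox I w (fun k ν i => A * r k ν i) →
      x ∈ limsupBox I w (fun k ν i => if (ν, i) ∈ B then r k ν i else A * r k ν i) := by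
    intro B
    induction B using Finset.induction_on with
    | empty => simp
    | insert c B hc ih =>
      have h := haar_limsupBox_diff_eq_zero I hI w
        (fun k ν i => if (ν, i) ∈ B then r k ν i else A * r k ν i)
        (fun k ν i => if (ν, i) ∈ insert c B then r k ν i else A * r k ν i) A δ hδ c.1 c.2
        (by simpa using fun K k hk => hr K k hk c.1 c.2) (by simp [hc]) (by
          intro k σ j h
          simp [h])
      filter_upwards [ih, measure_eq_zero_iff_ae_notMem.1 h] with x hx hx' hx0
      by_contra hcon
      exact hx' ⟨hx hx0, hcon⟩
  simpa using step Finset.univ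

/-! ### Dirichlet's theorem -/

/-- Scaling by `p ^ M` moves the values into ℤ_p, where congruence modulo `p ^ K` means closeness;
undoing the scaling costs `p ^ M`. -/
theorem norm_sub_le_of_toZModPow_eq {p : ℕ} [Fact p.Prime] {M K : ℕ} {u v : ℚ_[p]}
    {a b : ℤ_[p]} (ha : (a : ℚ_[p]) = (p : ℚ_[p]) ^ M * u) (hb : (b : ℚ_[p]) = (p : ℚ_[p]) ^ M * v)
    (h : PadicInt.toZModPow K a = PadicInt.toZModPow K b) :
    ‖u - v‖ ≤ (p : ℝ) ^ M / (p : ℝ) ^ K := by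
  have hp0 : (0 : ℝ) < p := by exact_mod_cast (Fact.out : p.Prime).pos
  rw [← sub_eq_zero, ← map_sub, ← RingHom.mem_ker, PadicInt.ker_toZModPow,
    ← PadicInt.norm_le_pow_iff_mem_span_pow] at h
  have h' : ‖(p : ℚ_[p]) ^ M * (u - v)‖ ≤ (p : ℝ) ^ (-(K : ℤ)) := by
    rwa [mul_sub, ← ha, ← hb, ← PadicInt.coe_sub, ← PadicInt.norm_def]
  rw [norm_mul, norm_pow, Padic.norm_p, zpow_neg, zpow_natCast, inv_pow,
    inv_mul_le_iff₀ (by positivity)] at h'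
  simpa [div_eq_mul_inv] using h'

/-- A weighted Dirichlet theorem for bounded `S`-adic forms. -/
theorem exists_int_vec_forms_le (S : Finset Nat.Primes) {n : ℕ}
    (L : ∀ ν : S, Fin n → (Fin (n + 1) → ℤ) → ℚ_[(ν.1 : ℕ)])
    (hL : ∀ ν i b b', L ν i (b - b') = L ν i b - L ν i b') (M : ℕ)
    (hM : ∀ ν i b, ‖L ν i b‖ ≤ ((ν.1 : ℕ) : ℝ) ^ M) (τ : Nat.Primes → Fin n → ℝ)
    (hτ : ∑ i, ∑ ν ∈ S, τ ν i = (n : ℝ) + 1) (c : S → Fin n → ℝ) (hc : ∀ ν i, 0 < c ν i)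
    (hprod : ∏ ν : S, ∏ i, (((ν.1 : ℕ) : ℝ) ^ (M + 1) / c ν i) ≤ 1) (H : ℕ) (hH : 1 ≤ H)
    (hcH : ∀ ν i, c ν i * (H : ℝ) ^ (-τ ν.1 i) ≤ ((ν.1 : ℕ) : ℝ) ^ M) :
    ∃ b : Fin (n + 1) → ℤ, b ≠ 0 ∧ ‖b‖ ≤ H ∧ ∀ ν i, ‖L ν i b‖ ≤ c ν i * (H : ℝ) ^ (-τ ν.1 i) := by
  classical
  have hH0 : (0 : ℝ) < H := by exact_mod_cast hH
  have hp : ∀ ν : S, (1 : ℝ) < ((ν.1 : ℕ) : ℝ) := fun ν => by exact_mod_cast ν.1.2.one_lt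
  have hp0 : ∀ ν : S, (0 : ℝ) < ((ν.1 : ℕ) : ℝ) := fun ν => one_pos.trans (hp ν)
  -- The modulus p^(k+1) is the first power of p above p^M / (c·H^(-τ)), so congruence forces the
  -- wanted bound. Rounding up costs at most one factor p, which explains the exponent `M + 1` in
  -- `hprod`.
  have hX : ∀ (ν : S) (i : Fin n), ∃ k : ℕ,
      ((ν.1 : ℕ) : ℝ) ^ k ≤ ((ν.1 : ℕ) : ℝ) ^ M / (c ν i * (H : ℝ) ^ (-τ ν.1 i)) ∧
      ((ν.1 : ℕ) : ℝ) ^ M / (c ν i * (H : ℝ) ^ (-τ ν.1 i)) < ((ν.1 : ℕ) : ℝ) ^ (k + 1) := by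
    intro ν i
    have h0 : 0 < c ν i * (H : ℝ) ^ (-τ ν.1 i) := mul_pos (hc ν i) (Real.rpow_pos_of_pos hH0 _)
    exact exists_nat_pow_near ((one_le_div h0).2 (hcH ν i)) (hp ν)
  choose k hk1 hk2 using hX
  have hbdd : ∀ (ν : S) i b, ‖((ν.1 : ℕ) : ℚ_[(ν.1 : ℕ)]) ^ M * L ν i b‖ ≤ 1 := by
    intro ν i b
    rw [norm_mul, norm_pow, Padic.norm_p, inv_pow]
    have := hp0 ν
    rw [inv_mul_le_iff₀ (by positivity), mul_one]
    exact hM ν i b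
  let vec : (Fin (n + 1) → Fin (H + 1)) → Fin (n + 1) → ℤ := fun a j => ((a j : ℕ) : ℤ)
  let Φ : (Fin (n + 1) → Fin (H + 1)) →
      ∀ ν : S, ∀ i : Fin n, ZMod ((ν.1 : ℕ) ^ (k ν i + 1)) :=
    fun a ν i => PadicInt.toZModPow (k ν i + 1) ⟨_, hbdd ν i (vec a)⟩
  have : ∀ (ν : S) (i : Fin n), NeZero ((ν.1 : ℕ) ^ (k ν i + 1)) := fun ν i =>
    ⟨pow_ne_zero _ ν.1.2.ne_zero⟩
  -- At most H^(n+1) residue classes face (H+1)^(n+1) vectors with entries in {0, …, H}.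
  have hcard : Fintype.card (∀ ν : S, ∀ i : Fin n, ZMod ((ν.1 : ℕ) ^ (k ν i + 1))) <
      Fintype.card (Fin (n + 1) → Fin (H + 1)) := by
    have : ((∏ ν : S, ∏ i : Fin n, (ν.1 : ℕ) ^ (k ν i + 1) : ℕ) : ℝ) ≤ (H : ℝ) ^ (n + 1) := by
      push_cast
      calc ∏ ν : S, ∏ i : Fin n, ((ν.1 : ℕ) : ℝ) ^ (k ν i + 1)
          ≤ ∏ ν : S, ∏ i : Fin n,
            (((ν.1 : ℕ) : ℝ) ^ (M + 1) / c ν i * (H : ℝ) ^ (τ ν.1 i)) := by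
            gcongr with ν _ i _
            calc ((ν.1 : ℕ) : ℝ) ^ (k ν i + 1) = ((ν.1 : ℕ) : ℝ) ^ (k ν i) * (ν.1 : ℕ) :=
                  pow_succ _ _
              _ ≤ ((ν.1 : ℕ) : ℝ) ^ M / (c ν i * (H : ℝ) ^ (-τ ν.1 i)) * (ν.1 : ℕ) := by
                  gcongr
                  exact hk1 ν i
              _ = _ := by
                  rw [Real.rpow_neg hH0.le, pow_succ]
                  have := (hc ν i).ne'
                  have := (Real.rpow_pos_of_pos hH0 (τ ν.1 i)).ne'
                  field_simp
        _ = (∏ ν : S, ∏ i : Fin n, (((ν.1 : ℕ) : ℝ) ^ (M + 1) / c ν i)) *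
            ∏ ν : S, ∏ i : Fin n, (H : ℝ) ^ (τ ν.1 i) := by
            simp only [Finset.prod_mul_distrib]
        _ ≤ 1 * ∏ ν : S, ∏ i : Fin n, (H : ℝ) ^ (τ ν.1 i) := by
            gcongr
        _ = (H : ℝ) ^ (∑ ν : S, ∑ i : Fin n, τ ν.1 i) := by
            rw [one_mul, Real.rpow_sum_of_pos hH0]
            refine Finset.prod_congr rfl fun ν _ => ?_
            rw [Real.rpow_sum_of_pos hH0]
        _ = (H : ℝ) ^ (n + 1) := by
            rw [Finset.sum_coe_sort S (fun ν => ∑ i, τ ν i), Finset.sum_comm, hτ]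
            exact_mod_cast Real.rpow_natCast (H : ℝ) (n + 1)
    simp only [Fintype.card_pi, ZMod.card, Fintype.card_fin, Finset.prod_const, Finset.card_univ]
    exact lt_of_le_of_lt (by exact_mod_cast this) (Nat.pow_lt_pow_left (Nat.lt_succ_self H) (by simp))
  obtain ⟨a, a', hne, heq⟩ := Fintype.exists_ne_map_eq_of_card_lt Φ hcard
  refine ⟨vec a - vec a', fun h => hne ?_, ?_, fun ν i => ?_⟩
  · funext j
    have := congrFun h j
    simp only [vec, Pi.sub_apply, Pi.zero_apply] at this
    exact Fin.ext (by omega)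
  · refine (pi_norm_le_iff_of_nonneg hH0.le).2 fun j => ?_
    rw [Int.norm_eq_abs]
    have h1 := (a j).2
    have h2 := (a' j).2
    have : |((a j : ℕ) : ℤ) - ((a' j : ℕ) : ℤ)| ≤ (H : ℤ) := by
      rw [abs_le]; constructor <;> omega
    calc |(((vec a - vec a') j : ℤ) : ℝ)| = ((|((a j : ℕ) : ℤ) - ((a' j : ℕ) : ℤ)| : ℤ) : ℝ) := by
          rw [Int.cast_abs]; rfl
      _ ≤ H := by exact_mod_cast this
  · rw [hL]
    refine (norm_sub_le_of_toZModPow_eq (a := ⟨_, hbdd ν i (vec a)⟩) (b := ⟨_, hbdd ν i (vec a')⟩) rfl rfl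
      (congrFun (congrFun heq ν) i)).trans ?_
    have h0 : 0 < c ν i * (H : ℝ) ^ (-τ ν.1 i) := mul_pos (hc ν i) (Real.rpow_pos_of_pos hH0 _)
    have := hp0 ν
    rw [div_le_iff₀ (by positivity), mul_comm, ← div_le_iff₀ h0]
    exact (hk2 ν i).le

/-! ### Taylor expansion -/

section Taylor

variable {K : Type*} [NontriviallyNormedField K] {E F : Type*}
  [NormedAddCommGroup E] [NormedSpace K E] [NormedAddCommGroup F] [NormedSpace K F]
  {f : E → F} {U : Set E} {g : E × E × K → F}

theorem isOpen_diffQuotDomain (hU : IsOpen U) : IsOpen (diffQuotDomain K U) := by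
  have h1 : Continuous fun z : E × E × K => z.1 := by fun_prop
  have h2 : Continuous fun z : E × E × K => z.1 + z.2.2 • z.2.1 := by fun_prop
  exact (hU.preimage h1).inter (hU.preimage h2)

/-- Identities for difference quotients need t ≠ 0 so that t can be cancelled. They reach t = 0 as
punctured limits along suitable paths φ. -/
theorem IsDiffQuot.tendsto (hg : IsDiffQuot K f U g) (hU : IsOpen U) {x : E} (hx : x ∈ U) (v : E)
    {φ : K → E × E × K} (hφ : ContinuousAt φ 0) (h0 : φ 0 = (x, v, 0)) :
    (∀ᶠ t in 𝓝[≠] (0 : K), φ t ∈ diffQuotDomain K U) ∧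
      Tendsto (fun t => g (φ t)) (𝓝[≠] 0) (𝓝 (g (x, v, 0))) := by
  have hmem : (x, v, (0 : K)) ∈ diffQuotDomain K U := ⟨hx, by simpa using hx⟩
  have hφ' : Tendsto φ (𝓝[≠] 0) (𝓝 (x, v, 0)) := by
    rw [← h0]
    exact hφ.tendsto.mono_left nhdsWithin_le_nhds
  have hn := (isOpen_diffQuotDomain hU).mem_nhds hmem
  exact ⟨hφ' hn, (hg.1.continuousAt hn).tendsto.comp hφ'⟩

/-- The same increment of f arises from direction a•v with step t and from direction v with step
t·a. -/
theorem IsDiffQuot.map_smul (hg : IsDiffQuot K f U g) (hU : IsOpen U) {x : E} (hx : x ∈ U)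
    (a : K) (v : E) : g (x, a • v, 0) = a • g (x, v, 0) := by
  obtain ⟨h1, h2⟩ := hg.tendsto hU hx (a • v) (φ := fun t => (x, a • v, t)) (by fun_prop) rfl
  obtain ⟨h3, h4⟩ := hg.tendsto hU hx v (φ := fun t => (x, v, t * a)) (by fun_prop) (by simp)
  refine tendsto_nhds_unique h2 ((h4.const_smul a).congr' ?_)
  filter_upwards [h1, h3, self_mem_nhdsWithin] with t ht1 ht3 ht0
  have e1 := hg.2 _ _ _ ht1
  have e3 := hg.2 _ _ _ ht3
  rw [smul_smul, e3, mul_smul] at e1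
  exact smul_right_injective F ht0 e1

/-- The increment along v + w telescopes through the intermediate point x + t•v. -/
theorem IsDiffQuot.map_add (hg : IsDiffQuot K f U g) (hU : IsOpen U) {x : E} (hx : x ∈ U)
    (v w : E) : g (x, v + w, 0) = g (x, v, 0) + g (x, w, 0) := by
  obtain ⟨h1, h2⟩ := hg.tendsto hU hx (v + w) (φ := fun t => (x, v + w, t)) (by fun_prop) rfl
  obtain ⟨h3, h4⟩ := hg.tendsto hU hx v (φ := fun t => (x, v, t)) (by fun_prop) rfl
  obtain ⟨h5, h6⟩ := hg.tendsto hU hx w (φ := fun t => (x + t • v, w, t)) (by fun_prop) (by simp)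
  refine tendsto_nhds_unique h2 ((h4.add h6).congr' ?_)
  filter_upwards [h1, h3, h5, self_mem_nhdsWithin] with t ht1 ht3 ht5 ht0
  have e1 := hg.2 _ _ _ ht1
  have e3 := hg.2 _ _ _ ht3
  have e5 := hg.2 _ _ _ ht5
  refine smul_right_injective F ht0 ?_
  change t • (g (x, v, t) + g (x + t • v, w, t)) = t • g (x, v + w, t)
  rw [smul_add, ← e1, ← e3, ← e5, smul_add, add_assoc]
  abel

end Taylor

/-- The second order Taylor estimate at a point for `C²` maps over `ℚ_p`. -/
theorem IsC2On.exists_taylor {p : ℕ} [Fact p.Prime] {d m : ℕ}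
    {f : (Fin d → ℚ_[p]) → (Fin m → ℚ_[p])} {U : Set (Fin d → ℚ_[p])} (hU : IsOpen U)
    (hf : IsC2On ℚ_[p] f U) {x : Fin d → ℚ_[p]} (hx : x ∈ U) :
    ∃ D : Fin m → Fin d → ℚ_[p], ∃ B > (0 : ℝ), ∃ δ > (0 : ℝ), (∀ j i, ‖D j i‖ ≤ B) ∧
      ∀ y, (∀ i, ‖y i - x i‖ ≤ δ) → y ∈ U ∧
        ∀ ρ, (∀ i, ‖y i - x i‖ ≤ ρ) →
          ∀ j, ‖f y j - f x j - ∑ i, D j i * (y i - x i)‖ ≤ B * ρ ^ 2 := by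
  obtain ⟨g, hg, h, hh⟩ := hf
  let D : Fin m → Fin d → ℚ_[p] := fun j i => g (x, Pi.single i 1, 0) j
  have hlin : ∀ v j, g (x, v, 0) j = ∑ i, D j i * v i := by
    let G : (Fin d → ℚ_[p]) →ₗ[ℚ_[p]] (Fin m → ℚ_[p]) :=
      { toFun := fun v => g (x, v, 0)
        map_add' := hg.map_add hU hx
        map_smul' := hg.map_smul hU hx }
    intro v j
    have := congrFun (G.pi_apply_eq_sum_univ v) j
    rw [show g (x, v, 0) j = G v j from rfl, this]
    simp only [Finset.sum_apply, Pi.smul_apply, smul_eq_mul]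
    refine Finset.sum_congr rfl fun i _ => ?_
    rw [mul_comm]
    congr 1
    change g (x, _, 0) j = g (x, _, 0) j
    congr 3
    funext l
    simp [Pi.single_apply, eq_comm]
  obtain ⟨δ, hδ, hδU⟩ := Metric.nhds_basis_closedBall.mem_iff.1 (hU.mem_nhds hx)
  let P : Set ((Fin d → ℚ_[p]) × ℚ_[p]) := closedBall 0 1 ×ˢ closedBall 0 δ
  have hP : IsCompact P := (isCompact_closedBall _ _).prod (isCompact_closedBall _ _)
  have hPU : ∀ z ∈ P, x + z.2 • z.1 ∈ U := by
    rintro ⟨v, t⟩ ⟨hv, ht⟩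
    refine hδU ?_
    simp only [mem_closedBall, dist_zero_right] at hv ht
    rw [mem_closedBall, dist_eq_norm, add_sub_cancel_left, norm_smul]
    calc ‖t‖ * ‖v‖ ≤ δ * 1 := by gcongr
      _ = δ := mul_one δ
  have hdom : ∀ z ∈ P, ((x, z.1, (0 : ℚ_[p])), (0, 0, (1 : ℚ_[p])), z.2) ∈
      diffQuotDomain ℚ_[p] (diffQuotDomain ℚ_[p] U) := by
    intro z hz
    refine ⟨⟨hx, by simpa using hx⟩, ?_⟩
    have := hPU z hz
    refine ⟨by simpa using hx, by simpa using this⟩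
  obtain ⟨B₁, hB₁⟩ := hP.exists_bound_of_continuousOn
    (f := fun z => h ((x, z.1, (0 : ℚ_[p])), (0, 0, (1 : ℚ_[p])), z.2))
    (hh.1.comp (by fun_prop) hdom)
  obtain ⟨B₂, hB₂⟩ : ∃ B₂, ∀ j i, ‖D j i‖ ≤ B₂ := by
    refine ⟨∑ j, ∑ i, ‖D j i‖, fun j i => ?_⟩
    exact (Finset.single_le_sum (f := fun i => ‖D j i‖) (fun i _ => norm_nonneg _)
      (Finset.mem_univ i)).trans (Finset.single_le_sum (f := fun j => ∑ i, ‖D j i‖)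
        (fun j _ => Finset.sum_nonneg fun i _ => norm_nonneg _) (Finset.mem_univ j))
  refine ⟨D, max 1 (max B₁ B₂), by positivity, δ, hδ,
    fun j i => (hB₂ j i).trans (by simp), fun y hy => ?_⟩
  have hyδ : ‖y - x‖ ≤ δ := (pi_norm_le_iff_of_nonneg hδ.le).2 hy
  refine ⟨hδU (by rwa [mem_closedBall, dist_eq_norm]), fun ρ hρ j => ?_⟩
  have hB0 : 0 ≤ max 1 (max B₁ B₂) := by positivity
  by_cases hyx : y = x
  · subst hyx
    simpa using mul_nonneg hB0 (sq_nonneg ρ)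
  -- Taking t to be a coordinate of y - x of maximal norm gives y = x + t•v with v in the unit ball.
  -- Applying the two difference quotients in turn shows the remainder to be t² times a value of h,
  -- which is bounded on the compact set `P`.
  obtain ⟨i₀, hi₀⟩ : ∃ i₀, ‖y - x‖ = ‖y i₀ - x i₀‖ := by
    have hne : Nonempty (Fin d) := by
      by_contra hemp
      rw [not_nonempty_iff] at hemp
      exact hyx (Subsingleton.elim _ _)
    obtain ⟨i₀, hi₀⟩ := Finite.exists_max fun i => ‖(y - x) i‖
    exact ⟨i₀, le_antisymm ((pi_norm_le_iff_of_nonneg (norm_nonneg _)).2 hi₀)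
      (norm_le_pi_norm (y - x) i₀)⟩
  set t := y i₀ - x i₀ with ht
  have ht0 : t ≠ 0 := by
    rw [← norm_ne_zero_iff, ← hi₀, norm_ne_zero_iff, sub_ne_zero]
    exact hyx
  set v := t⁻¹ • (y - x) with hv
  have htv : t • v = y - x := by rw [hv, smul_smul, mul_inv_cancel₀ ht0, one_smul]
  have hzP : (v, t) ∈ P := by
    refine ⟨?_, ?_⟩
    · rw [mem_closedBall, dist_zero_right, hv, norm_smul, norm_inv, hi₀,
        inv_mul_cancel₀ (norm_ne_zero_iff.2 ht0)]
    · rw [mem_closedBall, dist_zero_right, ← hi₀]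
      exact hyδ
  have e1 := hg.2 x v t ⟨hx, hPU _ hzP⟩
  have e2 := hh.2 _ _ _ (hdom _ hzP)
  have e3 : f y j - f x j - ∑ i, D j i * (y i - x i) =
      t * (t * h ((x, v, 0), (0, 0, 1), t) j) := by
    have a1 := congrFun e1 j
    have a2 := congrFun e2 j
    simp only [Prod.smul_mk, smul_zero, smul_eq_mul, mul_one, Prod.mk_add_mk, add_zero, zero_add,
      Pi.sub_apply, Pi.smul_apply] at a1 a2
    rw [htv, add_sub_cancel] at a1
    rw [a1, ← a2, hlin, mul_sub, Finset.mul_sum]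
    congr 1
    refine Finset.sum_congr rfl fun i _ => ?_
    rw [show y i - x i = t * v i from (congrFun htv i).symm]
    ring
  rw [e3, norm_mul, norm_mul]
  have hb : ‖h ((x, v, 0), (0, 0, 1), t) j‖ ≤ max 1 (max B₁ B₂) :=
    (norm_le_pi_norm _ j).trans ((hB₁ _ hzP).trans (by simp))
  have htρ : ‖t‖ ≤ ρ := hρ i₀
  have hρ0 : 0 ≤ ρ := (norm_nonneg t).trans htρ
  calc ‖t‖ * (‖t‖ * ‖h ((x, v, 0), (0, 0, 1), t) j‖)
      ≤ ρ * (ρ * max 1 (max B₁ B₂)) := by gcongr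
    _ = _ := by ring

/-! ### Approximating vectors -/

theorem padic_norm_sub_le_max {p : ℕ} [Fact p.Prime] (u v : ℚ_[p]) : ‖u - v‖ ≤ max ‖u‖ ‖v‖ := by
  rw [sub_eq_add_neg, ← norm_neg v]
  exact Padic.nonarchimedean _ _

/-- If arbitrarily good approximations to `y` occur in `A`, and `A` contains the multiples of
vectors giving `y` exactly, then `A` is infinite. -/
theorem infinite_of_recurrent {S : Finset Nat.Primes} {n : ℕ} {τ : Nat.Primes → Fin n → ℝ}
    (hτ : ∀ ν ∈ S, ∀ i, 0 < τ ν i) (y : QS S n) (C : ℝ) (A : Set (Fin (n + 1) → ℤ))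
    (hA : ∀ N : ℕ, ∃ H ≥ N, ∃ b ∈ A, b ≠ 0 ∧ ∀ (ν : S) i,
      ‖(b 0 : ℚ_[(ν.1 : ℕ)]) * y ν i - (b i.succ : ℚ_[(ν.1 : ℕ)])‖ ≤ C * (H : ℝ) ^ (-τ ν.1 i))
    (hmul : ∀ b : Fin (n + 1) → ℤ, (∀ (ν : S) i,
      (b 0 : ℚ_[(ν.1 : ℕ)]) * y ν i = (b i.succ : ℚ_[(ν.1 : ℕ)])) →
        ∀ k : ℤ, k • b ∈ A) : A.Infinite := by
  intro hfin
  choose H hH b hbA hb0 hb using hA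
  -- If A were finite, one vector would recur along unbounded H. Its error would then vanish, and
  -- its multiples would be infinitely many elements of A.
  have hex : ∃ a ∈ A, ∃ᶠ N in atTop, b N = a := by
    by_contra hcon
    simp only [not_exists, not_and, not_frequently] at hcon
    obtain ⟨N, hN⟩ := ((eventually_all_finite hfin).2 hcon).exists
    exact hN _ (hbA N) rfl
  obtain ⟨a, -, ha⟩ := hex
  have ha0 : a ≠ 0 := by
    obtain ⟨N, hN⟩ := ha.exists
    exact hN ▸ hb0 N
  have hHt : Tendsto (fun N => (H N : ℝ)) atTop atTop :=
    tendsto_natCast_atTop_atTop.comp (tendsto_atTop_mono hH tendsto_id)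
  have hexact : ∀ (ν : S) i, (a 0 : ℚ_[(ν.1 : ℕ)]) * y ν i = (a i.succ : ℚ_[(ν.1 : ℕ)]) := by
    intro ν i
    have hlim : Tendsto (fun N => C * (H N : ℝ) ^ (-τ ν.1 i)) atTop (𝓝 0) := by
      simpa using ((tendsto_rpow_neg_atTop (hτ ν.1 ν.2 i)).comp hHt).const_mul C
    have hle : ‖(a 0 : ℚ_[(ν.1 : ℕ)]) * y ν i - (a i.succ : ℚ_[(ν.1 : ℕ)])‖ ≤ 0 := by
      refine ge_of_tendsto_of_frequently hlim (ha.mono fun N hN => ?_)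
      rw [← hN]
      exact hb N ν i
    exact sub_eq_zero.1 (norm_le_zero_iff.1 hle)
  refine Set.infinite_of_injective_forall_mem (f := fun k : ℤ => k • a) (fun k l hkl => ?_)
    (fun k => hmul a hexact k) hfin
  obtain ⟨j, hj⟩ := Function.ne_iff.1 ha0
  have := congrFun hkl j
  simp only [Pi.smul_apply, smul_eq_mul] at this
  exact mul_right_cancel₀ hj this

theorem mem_W_of_recurrent {S : Finset Nat.Primes} {n : ℕ} {τ : Nat.Primes → Fin n → ℝ}
    (hτ : ∀ ν ∈ S, ∀ i, 0 < τ ν i) {y : QS S n} (hy : y ∈ ZS S n) {ε : ℝ} (hε : 0 < ε)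
    (h : ∀ N : ℕ, ∃ H ≥ N, ∃ b : Fin (n + 1) → ℤ, b ≠ 0 ∧ ‖b‖ ≤ H ∧ ∀ (ν : S) i,
      ‖(b 0 : ℚ_[(ν.1 : ℕ)]) * y ν i - (b i.succ : ℚ_[(ν.1 : ℕ)])‖ < ε * (H : ℝ) ^ (-τ ν.1 i)) :
    y ∈ W S τ ε := by
  refine ⟨hy, ?_⟩
  -- The zero vector is admitted vacuously so that the set is closed under all multiples of an exact
  -- solution; since `0 ^ (-τ) = 0`, it fails the strict inequality and is removed afterwards.
  have : ({b : Fin (n + 1) → ℤ | b ≠ 0 → ∀ (ν : S) (i : Fin n),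
    ‖(b 0 : ℚ_[(ν.1 : ℕ)]) * y ν i - (b i.succ : ℚ_[(ν.1 : ℕ)])‖ <
      ε * ‖b‖ ^ (-τ ν.1 i)}).Infinite := by
    refine infinite_of_recurrent hτ y ε _ (fun N => ?_) (fun b hb k hk ν i => ?_)
    · obtain ⟨H, hH, b, hb0, hbH, hb⟩ := h N
      refine ⟨H, hH, b, fun _ ν i => (hb ν i).trans_le ?_, hb0, fun ν i => (hb ν i).le⟩
      gcongr ε * ?_
      exact Real.rpow_le_rpow_of_nonpos (norm_pos_iff.2 hb0) hbH
        (by linarith [hτ ν.1 ν.2 i])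
    · have e : (((k • b) 0 : ℤ) : ℚ_[(ν.1 : ℕ)]) * y ν i -
          (((k • b) i.succ : ℤ) : ℚ_[(ν.1 : ℕ)]) = 0 := by
        simp only [Pi.smul_apply, smul_eq_mul, Int.cast_mul]
        rw [mul_assoc, hb ν i, sub_self]
      rw [e, norm_zero]
      exact mul_pos hε (Real.rpow_pos_of_pos (norm_pos_iff.2 hk) _)
  refine (this.sdiff (Set.finite_singleton 0)).mono ?_
  rintro b ⟨hb, hb0⟩
  exact hb (by simpa using hb0)

/-- `W` uses b₀y - b whereas `exponent` uses b₀y + b; changing the sign of b₀ translates between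
them. -/
theorem norm_cons_neg {n : ℕ} (b : Fin (n + 1) → ℤ) :
    ‖(Fin.cons (-b 0) fun i => b i.succ : Fin (n + 1) → ℤ)‖ = ‖b‖ := by
  refine le_antisymm ((pi_norm_le_iff_of_nonneg (norm_nonneg _)).2 fun j => ?_)
    ((pi_norm_le_iff_of_nonneg (norm_nonneg _)).2 fun j => ?_)
  · refine Fin.cases ?_ (fun i => ?_) j
    · simpa using norm_le_pi_norm b 0
    · simpa using norm_le_pi_norm b i.succ
  · refine Fin.cases ?_ (fun i => ?_) j
    · simpa using norm_le_pi_norm (Fin.cons (-b 0) fun i => b i.succ : Fin (n + 1) → ℤ) 0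
    · simpa using norm_le_pi_norm (Fin.cons (-b 0) fun i => b i.succ : Fin (n + 1) → ℤ) i.succ

/-- The error raised to the power 1/w is of order H^(-s), while ‖b‖^(-ω) is at least of order
H^(-κω). The gap κω < s absorbs the constants for large H. -/
theorem le_exponent_of_recurrent {T : Finset Nat.Primes} {n : ℕ} {w : Nat.Primes → Fin n → ℝ}
    (hw : ∀ ν ∈ T, ∀ i, 0 < w ν i) (y : QS T n) {s κ ω C : ℝ} (hs : 0 < s) (hω : 0 ≤ ω)
    (hκ : κ * ω < s) (hC : 0 < C)
    (h : ∀ N : ℕ, ∃ H ≥ N, ∃ b : Fin (n + 1) → ℤ, b ≠ 0 ∧ ‖b‖ ≤ C * (H : ℝ) ^ κ ∧ ∀ (ν : T) i,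
      ‖(b 0 : ℚ_[(ν.1 : ℕ)]) * y ν i - (b i.succ : ℚ_[(ν.1 : ℕ)])‖ ≤
        C * (H : ℝ) ^ (-(s * w ν.1 i))) :
    (ω : EReal) ≤ exponent T w y := by
  refine le_iSup₂_of_le (f := fun (ω : ℝ) _ => (ω : EReal)) ω ?_ le_rfl
  have hlarge : ∀ᶠ H : ℕ in atTop, ∀ (ν : T) (i : Fin n),
      C ^ (1 / w ν.1 i) * C ^ ω ≤ (H : ℝ) ^ (s - κ * ω) := by
    simp only [eventually_all]
    intro ν i
    exact ((tendsto_rpow_atTop (sub_pos.2 hκ)).comp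
      tendsto_natCast_atTop_atTop).eventually_ge_atTop _
  obtain ⟨N₀, hN₀⟩ := eventually_atTop.1 hlarge
  refine infinite_of_recurrent (τ := fun ν i => s * w ν i)
    (fun ν hν i => mul_pos hs (hw ν hν i)) (-y) C _ (fun N => ?_) (fun b hb k ν i => ?_)
  · obtain ⟨H, hH, b, hb0, hbH, hb⟩ := h (max (max N N₀) 1)
    have hH1 : 1 ≤ H := (le_max_right _ _).trans hH
    have hHN : max N N₀ ≤ H := (le_max_left _ _).trans hH
    have hHpos : (0 : ℝ) < H := by exact_mod_cast hH1
    have hbpos : 0 < ‖b‖ := norm_pos_iff.2 hb0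
    refine ⟨H, (le_max_left _ _).trans hHN, Fin.cons (-b 0) fun i => b i.succ,
      fun ν i => ?_, fun h0 => ?_, fun ν i => ?_⟩
    · have hwp := hw ν.1 ν.2 i
      rw [norm_cons_neg]
      simp only [Fin.cons_zero, Fin.cons_succ, Int.cast_neg]
      have e : ‖-(b 0 : ℚ_[(ν.1 : ℕ)]) * y ν i + (b i.succ : ℚ_[(ν.1 : ℕ)])‖ =
          ‖(b 0 : ℚ_[(ν.1 : ℕ)]) * y ν i - (b i.succ : ℚ_[(ν.1 : ℕ)])‖ := by
        rw [← norm_neg]; congr 1; ring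
      rw [e]
      calc _ ≤ (C * (H : ℝ) ^ (-(s * w ν.1 i))) ^ (1 / w ν.1 i) :=
            Real.rpow_le_rpow (norm_nonneg _) (hb ν i) (by positivity)
        _ = C ^ (1 / w ν.1 i) * (H : ℝ) ^ (-s) := by
            rw [Real.mul_rpow hC.le (by positivity), ← Real.rpow_mul hHpos.le]
            congr 2
            field_simp
        _ ≤ (C * (H : ℝ) ^ κ) ^ (-ω) := by
            rw [Real.mul_rpow hC.le (by positivity), ← Real.rpow_mul hHpos.le]
            have h1 := hN₀ H ((le_max_right _ _).trans hHN) ν i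
            have h2 : (H : ℝ) ^ (κ * -ω) = (H : ℝ) ^ (-s) * (H : ℝ) ^ (s - κ * ω) := by
              rw [← Real.rpow_add hHpos]; congr 1; ring
            rw [h2, Real.rpow_neg hC.le ω]
            have h3 : 0 < C ^ ω := Real.rpow_pos_of_pos hC _
            rw [le_inv_mul_iff₀ h3]
            calc C ^ ω * (C ^ (1 / w ν.1 i) * (H : ℝ) ^ (-s))
                = (H : ℝ) ^ (-s) * (C ^ (1 / w ν.1 i) * C ^ ω) := by ring
              _ ≤ _ := by gcongr
        _ ≤ ‖b‖ ^ (-ω) := Real.rpow_le_rpow_of_nonpos hbpos hbH (by linarith)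
    · have := norm_cons_neg b
      rw [h0, norm_zero] at this
      exact hbpos.ne this
    · simp only [Fin.cons_zero, Fin.cons_succ, Int.cast_neg, Pi.neg_apply, neg_mul_neg]
      exact hb ν i
  · have hwp := hw ν.1 ν.2 i
    have e : (((k • b) 0 : ℤ) : ℚ_[(ν.1 : ℕ)]) * y ν i +
        (((k • b) i.succ : ℤ) : ℚ_[(ν.1 : ℕ)]) = 0 := by
      have := hb ν i
      simp only [Pi.neg_apply] at this
      simp only [Pi.smul_apply, smul_eq_mul, Int.cast_mul]
      rw [← this]; ring
    rw [e, norm_zero, Real.zero_rpow (by positivity)]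
    exact Real.rpow_nonneg (norm_nonneg _) _

/-- A vector all of whose coordinates are `p`-adically small is divisible by a large power
of `p`. -/
theorem exists_eq_pow_mul {p : ℕ} [Fact p.Prime] {n : ℕ} {b : Fin n → ℤ} {H μ K : ℝ}
    (hH : 0 < H) (hK : 0 < K) (hKH : K ≤ H ^ μ) (hbH : ‖b‖ ≤ H)
    (hb : ∀ j, ‖(b j : ℚ_[p])‖ ≤ K * H ^ (-μ)) :
    ∃ (k : ℕ) (b' : Fin n → ℤ), (∀ j, b j = (p : ℤ) ^ k * b' j) ∧
      ‖b'‖ ≤ p * K * H ^ (1 - μ) := by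
  have hp : (1 : ℝ) < p := by exact_mod_cast (Fact.out : p.Prime).one_lt
  have hp0 : (0 : ℝ) < p := by linarith
  have hHμ : 0 < H ^ μ := Real.rpow_pos_of_pos hH _
  -- This is the largest k with p^k ≤ H^μ / K: divisibility by p^k is guaranteed, and maximality
  -- bounds the quotient up to a factor p.
  obtain ⟨k, hk1, hk2⟩ := exists_nat_pow_near ((one_le_div hK).2 hKH) hp
  have hdvd : ∀ j, ∃ c, b j = (p : ℤ) ^ k * c := by
    intro j
    have : (p : ℤ) ^ k ∣ b j := by
      rw [← Padic.norm_int_le_pow_iff_dvd]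
      refine (hb j).trans ?_
      rw [zpow_neg, zpow_natCast, Real.rpow_neg hH.le, le_inv_comm₀ (by positivity) (by positivity)]
      refine hk1.trans (le_of_eq ?_)
      field_simp
    exact this
  choose b' hb' using hdvd
  refine ⟨k, b', hb', (pi_norm_le_iff_of_nonneg (by positivity)).2 fun j => ?_⟩
  have h1 : (p : ℝ) ^ k * ‖b' j‖ ≤ H := by
    refine le_trans (le_of_eq ?_) ((norm_le_pi_norm b j).trans hbH)
    rw [hb' j, norm_mul, norm_pow]
    simp
  have h2 : H ^ μ < p * K * (p : ℝ) ^ k := by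
    rw [div_lt_iff₀ hK, pow_succ] at hk2
    linarith
  rw [Real.rpow_sub hH, Real.rpow_one, ← mul_div_assoc, le_div_iff₀ hHμ]
  calc ‖b' j‖ * H ^ μ ≤ ‖b' j‖ * (p * K * (p : ℝ) ^ k) := by gcongr
    _ = p * K * ((p : ℝ) ^ k * ‖b' j‖) := by ring
    _ ≤ _ := by gcongr

/-- Forget the coordinate at `ν`. -/
def forget {S : Finset Nat.Primes} {n : ℕ} (ν : Nat.Primes) (y : QS S n) : QS (S.erase ν) n :=
  fun σ => y ⟨σ.1, Finset.mem_of_mem_erase σ.2⟩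

/-- Approximating vectors with a `ν`-adically small leading coordinate yield exceptionally good
approximations over the remaining primes. -/
theorem le_norm_leading_coeff {S : Finset Nat.Primes} {n : ℕ} {τ : Nat.Primes → Fin n → ℝ}
    (hτ : ∀ ν ∈ S, ∀ i, 0 < τ ν i) {y : QS S n} (hy : y ∈ ZS S n) (ν : S) {μ s : ℝ}
    (hμ : 0 < μ) (hμτ : ∀ i, μ ≤ τ ν.1 i) (hs : μ ≤ 1 → 0 < s)
    (hsdef : s = 1 - (∑ k, τ ν.1 k) / ((n : ℝ) + 1))
    (hgen : μ ≤ 1 → ∃ ω : ℝ, 0 ≤ ω ∧ (1 - μ) * ω < s ∧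
      exponent (S.erase ν.1) (rescale τ ν.1) (forget ν.1 y) < ω) (C K : ℝ) :
    ∀ᶠ H : ℕ in atTop, ∀ b : Fin (n + 1) → ℤ, b ≠ 0 → ‖b‖ ≤ H →
      (∀ (σ : S) i, ‖(b 0 : ℚ_[(σ.1 : ℕ)]) * y σ i - (b i.succ : ℚ_[(σ.1 : ℕ)])‖ ≤
        C * (H : ℝ) ^ (-τ σ.1 i)) →
      K * (H : ℝ) ^ (-μ) ≤ ‖(b 0 : ℚ_[(ν.1 : ℕ)])‖ := by
  by_contra hcon
  rw [not_eventually] at hcon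
  have hp0 : (0 : ℝ) < (ν.1 : ℕ) := by exact_mod_cast ν.1.2.pos
  set K' := max (max K C) 1 with hK'
  have hK'0 : 0 < K' := by positivity
  -- As y is integral, a small b₀ and small errors at ν make every coordinate of b small at ν. The
  -- power of the prime ν that is divided out is a unit at each σ ≠ ν, so the errors there do not
  -- change.
  have hreduced : ∀ N : ℕ, ∃ H ≥ N, 1 ≤ H ∧ ∃ b : Fin (n + 1) → ℤ, b ≠ 0 ∧
      ‖b‖ ≤ (ν.1 : ℕ) * K' * (H : ℝ) ^ (1 - μ) ∧ ∀ (σ : S), σ ≠ ν → ∀ i,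
      ‖(b 0 : ℚ_[(σ.1 : ℕ)]) * y σ i - (b i.succ : ℚ_[(σ.1 : ℕ)])‖ ≤
        C * (H : ℝ) ^ (-τ σ.1 i) := by
    intro N
    have hlarge : ∀ᶠ H : ℕ in atTop, K' ≤ (H : ℝ) ^ μ :=
      ((tendsto_rpow_atTop hμ).comp tendsto_natCast_atTop_atTop).eventually_ge_atTop _
    obtain ⟨H, hH, hHK, hHN, hH1⟩ := (hcon.and_eventually (hlarge.and
      ((eventually_ge_atTop N).and (eventually_ge_atTop 1)))).exists
    push Not at hH
    obtain ⟨b, hb0, hbH, hb, hbν⟩ := hH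
    have hHpos : (0 : ℝ) < H := by exact_mod_cast hH1
    have hH1' : (1 : ℝ) ≤ H := by exact_mod_cast hH1
    have h0 : ‖(b 0 : ℚ_[(ν.1 : ℕ)])‖ ≤ K' * (H : ℝ) ^ (-μ) :=
      hbν.le.trans (by gcongr; simp [hK'])
    have hall : ∀ j, ‖(b j : ℚ_[(ν.1 : ℕ)])‖ ≤ K' * (H : ℝ) ^ (-μ) := by
      refine Fin.cases h0 fun i => ?_
      have e : (b i.succ : ℚ_[(ν.1 : ℕ)]) = (b 0 : ℚ_[(ν.1 : ℕ)]) * y ν i -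
          ((b 0 : ℚ_[(ν.1 : ℕ)]) * y ν i - (b i.succ : ℚ_[(ν.1 : ℕ)])) := by ring
      rw [e]
      refine (padic_norm_sub_le_max _ _).trans (max_le ?_ ((hb ν i).trans ?_))
      · rw [norm_mul]
        calc _ ≤ K' * (H : ℝ) ^ (-μ) * 1 := by
              gcongr
              exact hy ν i
          _ = _ := mul_one _
      · have h1 : (H : ℝ) ^ (-τ ν.1 i) ≤ (H : ℝ) ^ (-μ) :=
          Real.rpow_le_rpow_of_exponent_le hH1' (by linarith [hμτ i])
        calc C * (H : ℝ) ^ (-τ ν.1 i) ≤ K' * (H : ℝ) ^ (-τ ν.1 i) := by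
              gcongr; simp [hK']
          _ ≤ _ := by gcongr
    obtain ⟨k, b', hb', hb'H⟩ := exists_eq_pow_mul hHpos hK'0 hHK hbH hall
    refine ⟨H, hHN, hH1, b', fun h => hb0 ?_, hb'H, fun σ hσ i => ?_⟩
    · funext j
      rw [hb' j, h]
      simp
    · have hσν : ‖((ν.1 : ℕ) : ℚ_[(σ.1 : ℕ)])‖ = 1 := by
        rw [Padic.norm_natCast_eq_one_iff]
        rw [Nat.coprime_primes σ.1.2 ν.1.2]
        exact fun h => hσ (Subtype.ext (Subtype.ext h))
      refine le_trans (le_of_eq ?_) (hb σ i)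
      rw [hb' 0, hb' i.succ]
      push_cast
      rw [mul_assoc, ← mul_sub, norm_mul, norm_pow, hσν, one_pow, one_mul]
  -- For μ ≤ 1 the reduced vectors force the exponent over the other primes up to ω. For μ > 1 their
  -- height tends to 0, impossible for nonzero integer vectors.
  by_cases hμ1 : μ ≤ 1
  · obtain ⟨ω, hω0, hωs, hω⟩ := hgen hμ1
    have hs := hs hμ1
    refine absurd hω (not_lt.2 ?_)
    refine le_exponent_of_recurrent (s := s) (κ := 1 - μ) (C := max C ((ν.1 : ℕ) * K'))
      (fun σ hσ i => ?_) _ hs hω0 hωs (lt_max_of_lt_right (by positivity)) fun N => ?_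
    · rw [rescale, ← hsdef]
      exact div_pos (hτ σ (Finset.mem_of_mem_erase hσ) i) hs
    · obtain ⟨H, hHN, hH1, b, hb0, hbH, hb⟩ := hreduced N
      have hHpos : (0 : ℝ) < H := by exact_mod_cast hH1
      refine ⟨H, hHN, b, hb0, hbH.trans (by gcongr; exact le_max_right _ _), fun σ i => ?_⟩
      rw [rescale, ← hsdef, mul_div_cancel₀ _ hs.ne']
      refine (hb ⟨σ.1, Finset.mem_of_mem_erase σ.2⟩ (fun h => ?_) i).trans
        (by gcongr; exact le_max_left _ _)
      exact Finset.ne_of_mem_erase σ.2 (congrArg Subtype.val h)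
  · push Not at hμ1
    have hlim : Tendsto (fun H : ℕ => (ν.1 : ℕ) * K' * (H : ℝ) ^ (1 - μ)) atTop (𝓝 0) := by
      have := ((tendsto_rpow_neg_atTop (sub_pos.2 hμ1)).comp
        tendsto_natCast_atTop_atTop).const_mul ((ν.1 : ℕ) * K')
      simpa using this
    obtain ⟨N, hN⟩ := eventually_atTop.1 (hlim.eventually_lt_const one_pos)
    obtain ⟨H, hHN, -, b, hb0, hbH, -⟩ := hreduced N
    obtain ⟨j, hj⟩ := Function.ne_iff.1 hb0
    have h1 : (1 : ℝ) ≤ ‖b j‖ := by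
      rw [Int.norm_eq_abs]
      exact_mod_cast Int.one_le_abs hj
    exact absurd ((h1.trans (norm_le_pi_norm b j)).trans hbH) (not_le.2 (hN H hHN))

/-! ### Forgetting one prime -/

theorem measurable_forget {S : Finset Nat.Primes} {d : ℕ} (ν : Nat.Primes) :
    Measurable (forget ν : QS S d → QS (S.erase ν) d) :=
  measurable_pi_lambda _ fun σ =>
    measurable_pi_apply (⟨σ.1, Finset.mem_of_mem_erase σ.2⟩ : S)

/-- The box `ℤ_ν^d` at the place `ν`. -/
def integralAt {S : Finset Nat.Primes} (d : ℕ) (ν : S) : Set (QS S d) :=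
  {x | ∀ i, ‖x ν i‖ ≤ 1}

/-- The discarded factor ℤ_ν^d has mass 1, so cylinders keep their measure. Hence null sets over the
remaining primes pull back to null sets within the integral points. -/
theorem map_forget_restrict_haar {S : Finset Nat.Primes} {d : ℕ} (ν : S) :
    ((haar S d).restrict (integralAt d ν)).map (forget ν.1) = haar (S.erase ν.1) d := by
  classical
  symm
  refine Measure.pi_eq fun s hs => ?_
  rw [Measure.map_apply (measurable_forget _) (MeasurableSet.univ_pi hs),
    Measure.restrict_apply (measurable_forget _ (MeasurableSet.univ_pi hs))]
  let m : ∀ σ : Nat.Primes, Measure (Fin d → ℚ_[(σ : ℕ)]) := fun σ =>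
    Measure.pi fun _ : Fin d => Measure.addHaarMeasure (unitBall σ)
  let s' : ∀ σ : Nat.Primes, Set (Fin d → ℚ_[(σ : ℕ)]) := fun σ =>
    if h : σ ∈ S.erase ν.1 then s ⟨σ, h⟩ else Set.pi Set.univ fun _ => closedBall 0 1
  have hs'ν : s' ν.1 = Set.pi Set.univ fun _ => closedBall 0 1 := by simp [s']
  have hs'σ : ∀ σ : S.erase ν.1, s' σ.1 = s σ := fun σ => by
    simp only [s']
    rw [dif_pos σ.2]
  have hset : forget ν.1 ⁻¹' (Set.univ.pi s) ∩ integralAt d ν =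
      Set.univ.pi fun σ : S => s' σ.1 := by
    ext x
    simp only [Set.mem_inter_iff, Set.mem_preimage, Set.mem_univ_pi]
    constructor
    · rintro ⟨h1, h2⟩ σ
      by_cases hσ : σ = ν
      · subst hσ
        rw [hs'ν]
        intro i _
        simpa using h2 i
      · have hmem : σ.1 ∈ S.erase ν.1 :=
          Finset.mem_erase.2 ⟨fun h => hσ (Subtype.ext h), σ.2⟩
        rw [hs'σ ⟨σ.1, hmem⟩]
        exact h1 ⟨σ.1, hmem⟩
    · intro h
      refine ⟨fun σ => ?_, fun i => ?_⟩
      · rw [← hs'σ σ]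
        exact h ⟨σ.1, Finset.mem_of_mem_erase σ.2⟩
      · have := h ν
        rw [hs'ν] at this
        simpa using this i (Set.mem_univ i)
  rw [hset]
  have hunit : m ν.1 (s' ν.1) = 1 := by
    rw [hs'ν]
    simp only [m]
    rw [Measure.pi_pi]
    refine Finset.prod_eq_one fun i _ => ?_
    exact Measure.addHaarMeasure_self (K₀ := unitBall ν.1)
  calc haar S d (Set.univ.pi fun σ : S => s' σ.1) = ∏ σ : S, m σ.1 (s' σ.1) :=
        Measure.pi_pi _ _
    _ = ∏ σ ∈ S, m σ (s' σ) := Finset.prod_coe_sort S fun σ => m σ (s' σ)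
    _ = ∏ σ ∈ S.erase ν.1, m σ (s' σ) := by
        rw [← Finset.mul_prod_erase S _ ν.2, hunit, one_mul]
    _ = ∏ σ : S.erase ν.1, m σ.1 (s' σ.1) :=
        (Finset.prod_coe_sort (S.erase ν.1) fun σ => m σ (s' σ)).symm
    _ = ∏ σ : S.erase ν.1, m σ.1 (s σ) := Finset.prod_congr rfl fun σ _ => by rw [hs'σ]

theorem ae_forget {S : Finset Nat.Primes} {d : ℕ} (ν : S) {P : QS (S.erase ν.1) d → Prop}
    (h : ∀ᵐ x ∂haar (S.erase ν.1) d, P x) :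
    ∀ᵐ x ∂haar S d, x ∈ ZS S d → P (forget ν.1 x) := by
  rw [← map_forget_restrict_haar ν] at h
  have h' := ae_of_ae_map (measurable_forget ν.1).aemeasurable h
  have hm : MeasurableSet (integralAt d ν) := by
    have : integralAt d ν = ⋂ i, {x : QS S d | ‖x ν i‖ ≤ 1} := by ext; simp [integralAt]
    rw [this]
    refine MeasurableSet.iInter fun i => ?_
    have hc : Continuous fun x : QS S d => ‖x ν i‖ := by fun_prop
    exact (isClosed_le hc continuous_const).measurableSet
  filter_upwards [(ae_restrict_iff' hm).1 h'] with x hx hxZ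
  exact hx fun i => hxZ ν i

/-! ### The local estimate -/

theorem padic_norm_sum_mul_le {p : ℕ} [Fact p.Prime] {d : ℕ} {D z : Fin d → ℚ_[p]} {M B : ℝ}
    (hM : 0 ≤ M) (hB : 0 ≤ B) (hD : ∀ i, ‖D i‖ ≤ M) (hz : ∀ i, ‖z i‖ ≤ B) :
    ‖∑ i, D i * z i‖ ≤ M * B := by
  refine IsUltrametricDist.norm_sum_le_of_forall_le_of_nonneg (mul_nonneg hM hB) fun i _ => ?_
  rw [norm_mul]
  exact mul_le_mul (hD i) (hz i) (norm_nonneg _) hM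

/-- The form at y is the sum of the corrected form at x, the linear term ∑ D(βy - a), and β times
the Taylor remainder. The first two are controlled by η and by θ ≤ κ. For the third, ‖y - x‖ ≤
C·min(κ, l)/‖β‖; bounding one factor of the square by κ and the other by l leaves M·C²·κ·l/‖β‖,
which `K * l ≤ ‖β‖` makes smaller than ε·κ. -/
theorem norm_graph_form_lt {p : ℕ} [Fact p.Prime] {d m : ℕ}
    {f : (Fin d → ℚ_[p]) → (Fin m → ℚ_[p])} {x y : Fin d → ℚ_[p]} {D : Fin m → Fin d → ℚ_[p]}
    {M C η ε K l : ℝ} (hM : 1 ≤ M) (hC : 0 < C) (hη : 0 < η) (hηC : η ≤ C) (hηε : M * η < ε)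
    (hK : 0 < K) (hKC : C * (M + 1) ≤ K) (hKε : M * C ^ 2 < ε * K) (hl : 0 < l)
    (hD : ∀ j i, ‖D j i‖ ≤ M)
    (hT : (∀ i, ‖y i - x i‖ ≤ 1 / (M + 1)) → ∀ ρ, (∀ i, ‖y i - x i‖ ≤ ρ) →
      ∀ j, ‖f y j - f x j - ∑ i, D j i * (y i - x i)‖ ≤ M * ρ ^ 2)
    {β : ℚ_[p]} {a : Fin d → ℚ_[p]} {a' : Fin m → ℚ_[p]} {θ : Fin d → ℝ} {κ : Fin m → ℝ}
    (hκ : ∀ j, 0 < κ j) (hθl : ∀ i, θ i ≤ l) (hθκ : ∀ i j, θ i ≤ κ j)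
    (hβ : K * l ≤ ‖β‖) (h1 : ∀ i, ‖β * x i - a i‖ ≤ C * θ i)
    (h2 : ∀ j, ‖β * f x j - a' j - ∑ i, D j i * (β * x i - a i)‖ ≤ η * κ j)
    (hy : ∀ i, ‖β * y i - a i‖ ≤ η * θ i) (j : Fin m) :
    ‖β * f y j - a' j‖ < ε * κ j := by
  have hβ0 : 0 < ‖β‖ := (mul_pos hK hl).trans_le hβ
  have hκj := hκ j
  have hdist : ∀ i, ‖y i - x i‖ ≤ C * min (κ j) l / ‖β‖ := by
    intro i
    rw [le_div_iff₀ hβ0, mul_comm, ← norm_mul]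
    have e : β * (y i - x i) = (β * y i - a i) - (β * x i - a i) := by ring
    have hθ : θ i ≤ min (κ j) l := le_min (hθκ i j) (hθl i)
    have hm0 : 0 ≤ min (κ j) l := by positivity
    rw [e]
    refine (padic_norm_sub_le_max _ _).trans (max_le ((hy i).trans ?_) ((h1 i).trans ?_))
    · calc η * θ i ≤ η * min (κ j) l := by gcongr
        _ ≤ _ := by gcongr
    · gcongr
  have hρ : C * min (κ j) l / ‖β‖ ≤ 1 / (M + 1) := by
    rw [div_le_div_iff₀ hβ0 (by linarith), one_mul]
    calc C * min (κ j) l * (M + 1) ≤ C * l * (M + 1) := by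
          gcongr
          exact min_le_right _ _
      _ = C * (M + 1) * l := by ring
      _ ≤ K * l := by gcongr
      _ ≤ _ := hβ
  have hT' := hT (fun i => (hdist i).trans hρ) _ hdist j
  have e : β * f y j - a' j = (β * f x j - a' j - ∑ i, D j i * (β * x i - a i)) +
      (∑ i, D j i * (β * y i - a i) +
        β * (f y j - f x j - ∑ i, D j i * (y i - x i))) := by
    have : ∑ i, D j i * (β * y i - a i) =
        ∑ i, D j i * (β * x i - a i) + β * ∑ i, D j i * (y i - x i) := by
      rw [Finset.mul_sum, ← Finset.sum_add_distrib]
      exact Finset.sum_congr rfl fun i _ => by ring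
    rw [this]
    ring
  rw [e]
  have b1 : η * κ j < ε * κ j := by
    gcongr
    nlinarith
  have b2 : ‖∑ i, D j i * (β * y i - a i)‖ < ε * κ j := by
    refine (padic_norm_sum_mul_le (by linarith) (by positivity) (hD j)
      (B := η * κ j) fun i => (hy i).trans ?_).trans_lt ?_
    · gcongr
      exact hθκ i j
    · rw [← mul_assoc]
      gcongr
  have b3 : ‖β * (f y j - f x j - ∑ i, D j i * (y i - x i))‖ < ε * κ j := by
    rw [norm_mul]
    refine (mul_le_mul_of_nonneg_left hT' hβ0.le).trans_lt ?_
    have e3 : ‖β‖ * (M * (C * min (κ j) l / ‖β‖) ^ 2) =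
        M * C ^ 2 * (min (κ j) l * min (κ j) l) / ‖β‖ := by
      field_simp
    rw [e3, div_lt_iff₀ hβ0]
    calc M * C ^ 2 * (min (κ j) l * min (κ j) l) ≤ M * C ^ 2 * (κ j * l) := by
          gcongr
          · exact min_le_left _ _
          · exact min_le_right _ _
      _ < ε * K * (κ j * l) := by gcongr
      _ = ε * κ j * (K * l) := by ring
      _ ≤ ε * κ j * ‖β‖ := by
          have : 0 < ε := lt_trans (by positivity) hηε
          gcongr
  refine (Padic.nonarchimedean _ _).trans_lt (max_lt ((h2 j).trans_lt b1) ?_)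
  exact (Padic.nonarchimedean _ _).trans_lt (max_lt b2 b3)

/-- The Taylor estimate with constant `M` at each component of `x`. -/
def HasTaylor (S : Finset Nat.Primes) {d m : ℕ}
    (U : ∀ ν : Nat.Primes, Set (Fin d → ℚ_[(ν : ℕ)]))
    (f : ∀ ν : Nat.Primes, (Fin d → ℚ_[(ν : ℕ)]) → (Fin m → ℚ_[(ν : ℕ)])) (M : ℝ)
    (x : QS S d) : Prop :=
  ∀ ν : S, ∃ D : Fin m → Fin d → ℚ_[(ν.1 : ℕ)], (∀ j i, ‖D j i‖ ≤ M) ∧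
    ∀ y, (∀ i, ‖y i - x ν i‖ ≤ 1 / (M + 1)) → y ∈ U ν.1 ∧ ∀ ρ, (∀ i, ‖y i - x ν i‖ ≤ ρ) →
      ∀ j, ‖f ν.1 y j - f ν.1 (x ν) j - ∑ i, D j i * (y i - x ν i)‖ ≤ M * ρ ^ 2

/-- One constant serves the finitely many places. Taking it from the natural numbers splits the
domain into countably many pieces with uniform Taylor constants. -/
theorem exists_hasTaylor {S : Finset Nat.Primes} {d m : ℕ}
    {U : ∀ ν : Nat.Primes, Set (Fin d → ℚ_[(ν : ℕ)])}
    {f : ∀ ν : Nat.Primes, (Fin d → ℚ_[(ν : ℕ)]) → (Fin m → ℚ_[(ν : ℕ)])}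
    (hU : ∀ ν ∈ S, IsOpen (U ν)) (hf : ∀ ν ∈ S, IsC2On ℚ_[(ν : ℕ)] (f ν) (U ν))
    {x : QS S d} (hx : x ∈ domain S U) : ∃ M : ℕ, HasTaylor S U f ((M : ℝ) + 1) x := by
  choose D B hB δ hδ hD hT using fun ν : S =>
    IsC2On.exists_taylor (hU ν.1 ν.2) (hf ν.1 ν.2) (hx ν)
  have hev : ∀ᶠ M : ℕ in atTop, ∀ ν, B ν ≤ M ∧ 1 / δ ν ≤ M := by
    rw [eventually_all]
    exact fun ν => (tendsto_natCast_atTop_atTop.eventually_ge_atTop _).and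
      (tendsto_natCast_atTop_atTop.eventually_ge_atTop _)
  obtain ⟨M, hM⟩ := hev.exists
  refine ⟨M, fun ν => ⟨D ν, fun j i => (hD ν j i).trans ?_, fun y hy => ?_⟩⟩
  · linarith [(hM ν).1]
  · have hle : 1 / ((M : ℝ) + 1 + 1) ≤ δ ν := by
      rw [one_div_le (by positivity) (hδ ν)]
      linarith [(hM ν).2]
    refine ⟨(hT ν y fun i => (hy i).trans hle).1, fun ρ hρ j => ?_⟩
    refine ((hT ν y fun i => (hy i).trans hle).2 ρ hρ j).trans ?_
    gcongr
    linarith [(hM ν).1]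

/-! ### Generic points, rescaled weights and constants -/

/-- The components of `y` at the primes other than `ν` are not too well approximable. -/
def IsGeneric (S : Finset Nat.Primes) {n : ℕ} (τ : Nat.Primes → Fin n → ℝ) (y : QS S n) : Prop :=
  ∀ ν : S, (⨅ i, τ ν.1 i) ≤ 1 → ∃ ω : ℝ, 0 ≤ ω ∧
    (1 - ⨅ i, τ ν.1 i) * ω < 1 - (∑ k, τ ν.1 k) / ((n : ℝ) + 1) ∧
      exponent (S.erase ν.1) (rescale τ ν.1) (forget ν.1 y) < ω

/-- The rescaled weights over the remaining primes are normalised and admissible. -/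
theorem rescale_admissible {S : Finset Nat.Primes} {n : ℕ} {τ : Nat.Primes → Fin n → ℝ}
    (hτ : IsWeight S τ) (hτ_dist : ∀ ν ∈ S, ∀ j, (∑ i, τ ν i) / ((n : ℝ) + 1) < τ ν j)
    {ν : Nat.Primes} (hν : ν ∈ S) (hs : 0 < 1 - (∑ k, τ ν k) / ((n : ℝ) + 1)) :
    IsWeight (S.erase ν) (rescale τ ν) ∧ ∀ i, 1 < ∑ σ ∈ S.erase ν, rescale τ ν σ i := by
  have hn : (0 : ℝ) < (n : ℝ) + 1 := by positivity
  have hsum : ∑ σ ∈ S.erase ν, ∑ i, τ σ i = (n : ℝ) + 1 - ∑ k, τ ν k := by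
    have h1 := hτ.2
    rw [Finset.sum_comm, ← Finset.add_sum_erase S _ hν] at h1
    linarith
  have hsum' : ∑ σ ∈ S.erase ν, (∑ i, τ σ i) / ((n : ℝ) + 1) =
      1 - (∑ k, τ ν k) / ((n : ℝ) + 1) := by
    rw [← Finset.sum_div, hsum]
    field_simp
  refine ⟨⟨fun σ hσ i => div_pos (hτ.1 σ (Finset.mem_of_mem_erase hσ) i) hs, ?_⟩, fun i => ?_⟩
  · rw [Finset.sum_comm]
    simp only [rescale, ← Finset.sum_div]
    rw [hsum, div_eq_iff hs.ne']
    field_simp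
  · simp only [rescale, ← Finset.sum_div]
    rw [one_lt_div hs, ← hsum']
    -- Compare τ_{i,σ} with (∑_k τ_{k,σ})/(n+1) at each σ ≠ ν; the latter sum to the normalising
    -- factor. Some such σ exists, since that factor is positive.
    refine Finset.sum_lt_sum_of_nonempty ?_ fun σ hσ =>
      hτ_dist σ (Finset.mem_of_mem_erase hσ) i
    by_contra hemp
    rw [Finset.not_nonempty_iff_eq_empty] at hemp
    rw [hemp, Finset.sum_empty] at hsum'
    linarith

/-- A large C in the first d slots compensates for a small η in the other m, because d ≥ 1 and S is
nonempty. -/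
theorem exists_dirichlet_const {S : Finset Nat.Primes} (hS : S.Nonempty) {d : ℕ} (hd : 1 ≤ d)
    (m M : ℕ) (η : ℝ) :
    ∃ C : ℝ, η ≤ C ∧ ∏ ν : S, ∏ i : Fin (d + m), (((ν.1 : ℕ) : ℝ) ^ (M + 1) /
      Fin.append (fun _ : Fin d => C) (fun _ : Fin m => η) i) ≤ 1 := by
  set G := ∏ ν : S, ((((ν.1 : ℕ) : ℝ) ^ (M + 1)) ^ d * (((ν.1 : ℕ) : ℝ) ^ (M + 1) / η) ^ m)
  set C := max (max 1 η) G
  have hC1 : 1 ≤ C := (le_max_left _ _).trans (le_max_left _ _)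
  have hC0 : 0 < C := one_pos.trans_le hC1
  refine ⟨C, (le_max_right _ _).trans (le_max_left _ _), ?_⟩
  have e : ∀ ν : S, ∏ i : Fin (d + m), (((ν.1 : ℕ) : ℝ) ^ (M + 1) /
      Fin.append (fun _ : Fin d => C) (fun _ : Fin m => η) i) =
      ((((ν.1 : ℕ) : ℝ) ^ (M + 1)) ^ d * (((ν.1 : ℕ) : ℝ) ^ (M + 1) / η) ^ m) / C ^ d := by
    intro ν
    rw [Fin.prod_univ_add]
    simp only [Fin.append_left, Fin.append_right, Finset.prod_const, Finset.card_univ,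
      Fintype.card_fin]
    rw [div_pow _ C]
    ring
  simp only [e, Finset.prod_div_distrib, Finset.prod_const]
  rw [div_le_one (by positivity), ← pow_mul]
  have hcard : (Finset.univ : Finset S).card ≠ 0 := by
    rw [Finset.card_univ, Fintype.card_coe]
    exact hS.card_ne_zero
  calc G ≤ C := le_max_right _ _
    _ ≤ C ^ (d * (Finset.univ : Finset S).card) := le_self_pow₀ hC1 (by
        exact mul_ne_zero (by omega) hcard)

theorem norm_sub_div_le_iff {p : ℕ} [Fact p.Prime] {β z a : ℚ_[p]} (hβ : 0 < ‖β‖) {r : ℝ} :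
    ‖z - a / β‖ ≤ r / ‖β‖ ↔ ‖β * z - a‖ ≤ r := by
  rw [le_div_iff₀ hβ, ← norm_mul]
  have : (z - a / β) * β = β * z - a := by
    have := norm_pos_iff.1 hβ
    field_simp
  rw [this]

/-! ### Approximants at generic points, and the conclusion -/

section Main

variable {S : Finset Nat.Primes} {d m : ℕ}
  {U : ∀ ν : Nat.Primes, Set (Fin d → ℚ_[(ν : ℕ)])}
  {f : ∀ ν : Nat.Primes, (Fin d → ℚ_[(ν : ℕ)]) → (Fin m → ℚ_[(ν : ℕ)])}
  {τ : Nat.Primes → Fin (d + m) → ℝ}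

theorem param_mem_ZS (hUZ : ∀ ν ∈ S, ∀ x ∈ U ν, ∀ i, ‖x i‖ ≤ 1)
    (hfZ : ∀ ν ∈ S, ∀ x ∈ U ν, ∀ j, ‖f ν x j‖ ≤ 1) {x : QS S d} (hx : x ∈ domain S U) :
    param S f x ∈ ZS S (d + m) := by
  intro ν i
  refine Fin.addCases (fun i => ?_) (fun j => ?_) i
  · simpa [param] using hUZ ν.1 ν.2 _ (hx ν) i
  · simpa [param] using hfZ ν.1 ν.2 _ (hx ν) j

/-- The vectors `b` of height at most `H`, with `b₀` not too small at any prime, such that the box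
of size `η` about the point `(bᵢ / b₀)` is mapped to points well approximated by `b`. -/
def approxFamily (S : Finset Nat.Primes)
    (f : ∀ ν : Nat.Primes, (Fin d → ℚ_[(ν : ℕ)]) → (Fin m → ℚ_[(ν : ℕ)]))
    (τ : Nat.Primes → Fin (d + m) → ℝ) (ε η : ℝ) (K : ℕ) : Set ((Fin (d + m + 1) → ℤ) × ℕ) :=
  {k | k.1 ≠ 0 ∧ ‖k.1‖ ≤ k.2 ∧ 1 ≤ k.2 ∧ K ≤ k.2 ∧
    (∀ ν : S, ((K : ℝ) + 1) * (k.2 : ℝ) ^ (-⨅ i, τ ν.1 i) ≤ ‖(k.1 0 : ℚ_[(ν.1 : ℕ)])‖) ∧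
    ∀ x : QS S d, (∀ (ν : S) (i : Fin d), ‖(k.1 0 : ℚ_[(ν.1 : ℕ)]) * x ν i -
        (k.1 (Fin.castAdd m i).succ : ℚ_[(ν.1 : ℕ)])‖ ≤ η * (k.2 : ℝ) ^ (-τ ν.1 (Fin.castAdd m i))) →
      ∀ (ν : S) (i : Fin (d + m)), ‖(k.1 0 : ℚ_[(ν.1 : ℕ)]) * param S f x ν i -
        (k.1 i.succ : ℚ_[(ν.1 : ℕ)])‖ < ε * (k.2 : ℝ) ^ (-τ ν.1 i)}

theorem antitone_approxFamily (ε η : ℝ) : Antitone (approxFamily S f τ ε η) := by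
  rintro K K' hK k ⟨h1, h2, h3, h4, h5, h6⟩
  refine ⟨h1, h2, h3, hK.trans h4, fun ν => le_trans ?_ (h5 ν), h6⟩
  gcongr

theorem norm_pos_of_mem_approxFamily {ε η : ℝ} {K : ℕ} {k : (Fin (d + m + 1) → ℤ) × ℕ}
    (hk : k ∈ approxFamily S f τ ε η K) (ν : S) : 0 < ‖(k.1 0 : ℚ_[(ν.1 : ℕ)])‖ := by
  refine lt_of_lt_of_le ?_ (hk.2.2.2.2.1 ν)
  have : (0 : ℝ) < k.2 := by exact_mod_cast hk.2.2.1
  positivity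

/-- Every generic point lies in the large boxes of `approxFamily`. -/
theorem exists_mem_approxFamily (hd : 1 ≤ d)
    (hUZ : ∀ ν ∈ S, ∀ x ∈ U ν, ∀ i, ‖x i‖ ≤ 1) (hfZ : ∀ ν ∈ S, ∀ x ∈ U ν, ∀ j, ‖f ν x j‖ ≤ 1)
    (hτ : IsWeight S τ)
    (hτ_dom : ∀ ν ∈ S, ∀ (i : Fin d) (j : Fin m), τ ν (Fin.natAdd d j) ≤ τ ν (Fin.castAdd m i))
    (hτ_dist : ∀ ν ∈ S, ∀ j, (∑ i, τ ν i) / (((d + m : ℕ) : ℝ) + 1) < τ ν j)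
    {ε η C : ℝ} {M : ℕ} (hη : 0 < η) (hηC : η ≤ C) (hηε : ((M : ℝ) + 1) * η < ε)
    (hprod : ∏ ν : S, ∏ i : Fin (d + m), (((ν.1 : ℕ) : ℝ) ^ (M + 1 + 1) /
      Fin.append (fun _ : Fin d => C) (fun _ : Fin m => η) i) ≤ 1)
    {x : QS S d} (hx : x ∈ domain S U) (hT : HasTaylor S U f ((M : ℝ) + 1) x)
    (hgen : IsGeneric S τ (param S f x)) (K : ℕ) :
    ∃ k ∈ approxFamily S f τ ε η K, ∀ (ν : S) (i : Fin d), ‖(k.1 0 : ℚ_[(ν.1 : ℕ)]) * x ν i -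
        (k.1 (Fin.castAdd m i).succ : ℚ_[(ν.1 : ℕ)])‖ ≤
          C * (k.2 : ℝ) ^ (-τ ν.1 (Fin.castAdd m i)) := by
  have hC : 0 < C := hη.trans_le hηC
  have hM1 : (1 : ℝ) ≤ (M : ℝ) + 1 := by simp
  have hM0 : (0 : ℝ) ≤ (M : ℝ) + 1 := by positivity
  have hε : 0 < ε := lt_trans (by positivity) hηε
  have hy := param_mem_ZS hUZ hfZ hx
  have : Nonempty (Fin (d + m)) := ⟨⟨0, by omega⟩⟩
  have hinf : ∀ ν i, (⨅ i, τ ν i) ≤ τ ν i := fun ν i => ciInf_le (Set.finite_range _).bddBelow i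
  have hatt : ∀ ν, ∃ i, τ ν i = ⨅ i, τ ν i := fun ν => exists_eq_ciInf_of_finite
  have hinf0 : ∀ ν ∈ S, 0 < ⨅ i, τ ν i := fun ν hν => by
    obtain ⟨i, hi⟩ := hatt ν
    exact hi ▸ hτ.1 ν hν i
  choose D hD hDT using hT
  let c : S → Fin (d + m) → ℝ := fun _ => Fin.append (fun _ => C) (fun _ => η)
  have hc : ∀ ν i, 0 < c ν i := fun ν i => by
    refine Fin.addCases (fun i => ?_) (fun j => ?_) i
    · simpa [c] using hC
    · simpa [c] using hη
  -- The last m forms carry the tangential correction, so that their smallness persists when x moves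
  -- within the box.
  let L : ∀ ν : S, Fin (d + m) → (Fin (d + m + 1) → ℤ) → ℚ_[(ν.1 : ℕ)] := fun ν i b =>
    Fin.append
      (fun i : Fin d => (b 0 : ℚ_[(ν.1 : ℕ)]) * x ν i - (b (Fin.castAdd m i).succ : ℚ_[(ν.1 : ℕ)]))
      (fun j : Fin m => (b 0 : ℚ_[(ν.1 : ℕ)]) * f ν.1 (x ν) j -
        (b (Fin.natAdd d j).succ : ℚ_[(ν.1 : ℕ)]) - ∑ i, D ν j i *
          ((b 0 : ℚ_[(ν.1 : ℕ)]) * x ν i - (b (Fin.castAdd m i).succ : ℚ_[(ν.1 : ℕ)]))) i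
  have hbdd : ∀ (ν : S) (z : ℚ_[(ν.1 : ℕ)]), ‖z‖ ≤ 1 → ∀ s t : ℤ, ‖(s : ℚ_[(ν.1 : ℕ)]) * z - t‖ ≤ 1 := by
    intro ν z hz s t
    refine (padic_norm_sub_le_max _ _).trans (max_le ?_ (Padic.norm_int_le_one t))
    rw [norm_mul]
    exact mul_le_one₀ (Padic.norm_int_le_one s) (norm_nonneg _) hz
  have hxZ := fun (ν : S) i => hUZ ν.1 ν.2 _ (hx ν) i
  have hfxZ := fun (ν : S) j => hfZ ν.1 ν.2 _ (hx ν) j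
  have hLbound : ∀ ν i b, ‖L ν i b‖ ≤ ((ν.1 : ℕ) : ℝ) ^ (M + 1) := by
    intro ν i b
    have hpow : (M : ℝ) + 1 ≤ ((ν.1 : ℕ) : ℝ) ^ (M + 1) := by
      exact_mod_cast (Nat.lt_pow_self ν.1.2.one_lt).le
    refine le_trans ?_ hpow
    refine Fin.addCases (fun i => ?_) (fun j => ?_) i
    · simp only [L, Fin.append_left]
      exact (hbdd ν _ (hxZ ν i) _ _).trans hM1
    · simp only [L, Fin.append_right]
      refine (padic_norm_sub_le_max _ _).trans (max_le ((hbdd ν _ (hfxZ ν j) _ _).trans hM1) ?_)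
      have := padic_norm_sum_mul_le hM0 zero_le_one (hD ν j)
        fun i => hbdd ν _ (hxZ ν i) (b 0) (b (Fin.castAdd m i).succ)
      simpa using this
  have hLsub : ∀ ν i b b', L ν i (b - b') = L ν i b - L ν i b' := by
    intro ν i b b'
    refine Fin.addCases (fun i => ?_) (fun j => ?_) i
    · simp only [L, Fin.append_left, Pi.sub_apply, Int.cast_sub]
      ring
    · simp only [L, Fin.append_right, Pi.sub_apply, Int.cast_sub]
      have : ∀ i, D ν j i * (((b 0 : ℚ_[(ν.1 : ℕ)]) - b' 0) * x ν i -
          ((b (Fin.castAdd m i).succ : ℚ_[(ν.1 : ℕ)]) - b' (Fin.castAdd m i).succ)) =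
          D ν j i * ((b 0 : ℚ_[(ν.1 : ℕ)]) * x ν i - (b (Fin.castAdd m i).succ : ℚ_[(ν.1 : ℕ)])) -
          D ν j i * ((b' 0 : ℚ_[(ν.1 : ℕ)]) * x ν i -
            (b' (Fin.castAdd m i).succ : ℚ_[(ν.1 : ℕ)])) := fun i => by ring
      simp only [this, Finset.sum_sub_distrib]
      ring
  -- The three summands meet the three demands on ‖b₀‖: membership in the `K`-th family, validity of
  -- the Taylor estimate, and absorption of its quadratic error. The factor 2 makes the last
  -- inequality strict.
  set Q : ℝ := (K : ℝ) + 1 + C * ((M : ℝ) + 1 + 1) + 2 * (((M : ℝ) + 1) * C ^ 2) / ε with hQ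
  have hq1 : (K : ℝ) + 1 ≤ Q := by
    have : 0 ≤ C * ((M : ℝ) + 1 + 1) + 2 * (((M : ℝ) + 1) * C ^ 2) / ε := by positivity
    linarith
  have hq2 : C * ((M : ℝ) + 1 + 1) ≤ Q := by
    have : 0 ≤ (K : ℝ) + 1 + 2 * (((M : ℝ) + 1) * C ^ 2) / ε := by positivity
    linarith
  have hQ0 : 0 < Q := lt_of_lt_of_le (by positivity) hq1
  have hq3 : ((M : ℝ) + 1) * C ^ 2 < ε * Q := by
    have h1 : 2 * (((M : ℝ) + 1) * C ^ 2) / ε ≤ Q := by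
      have : 0 ≤ (K : ℝ) + 1 + C * ((M : ℝ) + 1 + 1) := by positivity
      linarith
    rw [div_le_iff₀ hε] at h1
    have : 0 < ((M : ℝ) + 1) * C ^ 2 := by positivity
    linarith
  have hev1 : ∀ᶠ H : ℕ in atTop, ∀ ν i, c ν i * (H : ℝ) ^ (-τ ν.1 i) ≤ ((ν.1 : ℕ) : ℝ) ^ (M + 1) := by
    simp only [eventually_all]
    intro ν i
    have hlim : Tendsto (fun H : ℕ => c ν i * (H : ℝ) ^ (-τ ν.1 i)) atTop (𝓝 0) := by
      simpa using ((tendsto_rpow_neg_atTop (hτ.1 ν.1 ν.2 i)).comp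
        tendsto_natCast_atTop_atTop).const_mul (c ν i)
    have hp0 : (0 : ℝ) < (ν.1 : ℕ) := by exact_mod_cast ν.1.2.pos
    exact hlim.eventually_le_const (by positivity)
  have hev2 := eventually_all.2 fun ν : S =>
    le_norm_leading_coeff hτ.1 hy ν (hinf0 ν.1 ν.2) (hinf ν.1)
      (s := 1 - (∑ k, τ ν.1 k) / (((d + m : ℕ) : ℝ) + 1)) (fun h => by
        obtain ⟨i, hi⟩ := hatt ν.1
        linarith [hτ_dist ν.1 ν.2 i]) rfl (hgen ν) (((M : ℝ) + 1) * C) Q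
  obtain ⟨H, hH1, hH2, hHK, hH⟩ := (hev1.and (hev2.and
    ((eventually_ge_atTop K).and (eventually_ge_atTop 1)))).exists
  have hHpos : (0 : ℝ) < H := by exact_mod_cast hH
  have hH1' : (1 : ℝ) ≤ H := by exact_mod_cast hH
  obtain ⟨b, hb0, hbH, hbL⟩ := exists_int_vec_forms_le S L hLsub (M + 1) hLbound τ hτ.2 c hc hprod
    H hH hH1
  have hrp : ∀ t : ℝ, 0 < (H : ℝ) ^ t := fun t => Real.rpow_pos_of_pos hHpos t
  have hdom : ∀ (ν : S) (i : Fin d) (j : Fin m),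
      (H : ℝ) ^ (-τ ν.1 (Fin.castAdd m i)) ≤ (H : ℝ) ^ (-τ ν.1 (Fin.natAdd d j)) :=
    fun ν i j => Real.rpow_le_rpow_of_exponent_le hH1' (neg_le_neg (hτ_dom ν.1 ν.2 i j))
  have hb1 : ∀ (ν : S) (i : Fin d), ‖(b 0 : ℚ_[(ν.1 : ℕ)]) * x ν i -
      (b (Fin.castAdd m i).succ : ℚ_[(ν.1 : ℕ)])‖ ≤ C * (H : ℝ) ^ (-τ ν.1 (Fin.castAdd m i)) := by
    intro ν i
    simpa [L, c] using hbL ν (Fin.castAdd m i)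
  have hb2 : ∀ (ν : S) (j : Fin m), ‖(b 0 : ℚ_[(ν.1 : ℕ)]) * f ν.1 (x ν) j -
        (b (Fin.natAdd d j).succ : ℚ_[(ν.1 : ℕ)]) - ∑ i, D ν j i *
          ((b 0 : ℚ_[(ν.1 : ℕ)]) * x ν i - (b (Fin.castAdd m i).succ : ℚ_[(ν.1 : ℕ)]))‖ ≤
      η * (H : ℝ) ^ (-τ ν.1 (Fin.natAdd d j)) := by
    intro ν j
    simpa [L, c] using hbL ν (Fin.natAdd d j)
  have hball : ∀ (ν : S) i, ‖(b 0 : ℚ_[(ν.1 : ℕ)]) * param S f x ν i -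
      (b i.succ : ℚ_[(ν.1 : ℕ)])‖ ≤ ((M : ℝ) + 1) * C * (H : ℝ) ^ (-τ ν.1 i) := by
    intro ν i
    refine Fin.addCases (fun i => ?_) (fun j => ?_) i
    · simp only [param, Fin.append_left]
      refine (hb1 ν i).trans ?_
      have := hrp (-τ ν.1 (Fin.castAdd m i))
      rw [mul_assoc]
      exact le_mul_of_one_le_left (by positivity) hM1
    · simp only [param, Fin.append_right]
      have h3 := padic_norm_sum_mul_le hM0 (mul_pos hC (hrp (-τ ν.1 (Fin.natAdd d j)))).le (hD ν j)
        fun i => (hb1 ν i).trans (mul_le_mul_of_nonneg_left (hdom ν i j) hC.le)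
      have e : (b 0 : ℚ_[(ν.1 : ℕ)]) * f ν.1 (x ν) j - (b (Fin.natAdd d j).succ : ℚ_[(ν.1 : ℕ)]) =
        ((b 0 : ℚ_[(ν.1 : ℕ)]) * f ν.1 (x ν) j -
          (b (Fin.natAdd d j).succ : ℚ_[(ν.1 : ℕ)]) - ∑ i, D ν j i *
          ((b 0 : ℚ_[(ν.1 : ℕ)]) * x ν i - (b (Fin.castAdd m i).succ : ℚ_[(ν.1 : ℕ)]))) +
        ∑ i, D ν j i *
          ((b 0 : ℚ_[(ν.1 : ℕ)]) * x ν i - (b (Fin.castAdd m i).succ : ℚ_[(ν.1 : ℕ)])) := by ring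
      rw [e]
      refine (Padic.nonarchimedean _ _).trans (max_le ((hb2 ν j).trans ?_) ?_)
      · have := hrp (-τ ν.1 (Fin.natAdd d j))
        gcongr
        nlinarith
      · rw [mul_assoc]
        exact h3
  have hlead : ∀ ν : S, Q * (H : ℝ) ^ (-⨅ i, τ ν.1 i) ≤ ‖(b 0 : ℚ_[(ν.1 : ℕ)])‖ :=
    fun ν => hH2 ν b hb0 hbH hball
  refine ⟨(b, H), ⟨hb0, hbH, hH, hHK, fun ν => le_trans ?_ (hlead ν), fun y hy ν i => ?_⟩, hb1⟩
  · gcongr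
  · refine Fin.addCases (fun i => ?_) (fun j => ?_) i
    · simp only [param, Fin.append_left]
      refine (hy ν i).trans_lt ?_
      have := hrp (-τ ν.1 (Fin.castAdd m i))
      gcongr
      nlinarith
    · simp only [param, Fin.append_right]
      exact norm_graph_form_lt hM1 hC hη hηC hηε hQ0 hq2 hq3 (hrp _) (hD ν)
        (fun h ρ hρ j => (hDT ν (y ν) h).2 ρ hρ j) (fun j => hrp _)
        (fun i => Real.rpow_le_rpow_of_exponent_le hH1' (neg_le_neg (hinf ν.1 _)))
        (hdom ν) (hlead ν) (hb1 ν) (hb2 ν) (hy ν) j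

/-- With M fixed, η and C do not depend on x. Generic points lie in all large boxes' limsup set with
constant C, and shrinking by the factor C/η puts almost all of them in the η-boxes, on which
approximation with constant ε is built in. -/
theorem ae_param_mem_W (hd : 1 ≤ d)
    (hUZ : ∀ ν ∈ S, ∀ x ∈ U ν, ∀ i, ‖x i‖ ≤ 1) (hfZ : ∀ ν ∈ S, ∀ x ∈ U ν, ∀ j, ‖f ν x j‖ ≤ 1)
    (hτ : IsWeight S τ)
    (hτ_dom : ∀ ν ∈ S, ∀ (i : Fin d) (j : Fin m), τ ν (Fin.natAdd d j) ≤ τ ν (Fin.castAdd m i))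
    (hτ_dist : ∀ ν ∈ S, ∀ j, (∑ i, τ ν i) / (((d + m : ℕ) : ℝ) + 1) < τ ν j)
    {ε : ℝ} (hε : 0 < ε) (M : ℕ) :
    ∀ᵐ x ∂haar S d, x ∈ domain S U → HasTaylor S U f ((M : ℝ) + 1) x →
      IsGeneric S τ (param S f x) → param S f x ∈ W S τ ε := by
  have hS : S.Nonempty := by
    by_contra h
    rw [Finset.not_nonempty_iff_eq_empty] at h
    have := hτ.2
    simp only [h, Finset.sum_empty, Finset.sum_const_zero] at this
    have h0 : (0 : ℝ) ≤ ((d + m : ℕ) : ℝ) := Nat.cast_nonneg _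
    linarith
  obtain ⟨η, hη, hηε⟩ : ∃ η : ℝ, 0 < η ∧ ((M : ℝ) + 1) * η < ε := by
    refine ⟨ε / (2 * ((M : ℝ) + 1)), by positivity, ?_⟩
    have : ((M : ℝ) + 1) * (ε / (2 * ((M : ℝ) + 1))) = ε / 2 := by field_simp
    linarith
  obtain ⟨C, hηC, hprod⟩ := exists_dirichlet_const hS hd m (M + 1) η
  let w : (Fin (d + m + 1) → ℤ) × ℕ → QS S d := fun k ν i =>
    (k.1 (Fin.castAdd m i).succ : ℚ_[(ν.1 : ℕ)]) / (k.1 0 : ℚ_[(ν.1 : ℕ)])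
  let r : (Fin (d + m + 1) → ℤ) × ℕ → S → Fin d → ℝ := fun k ν i =>
    η * (k.2 : ℝ) ^ (-τ ν.1 (Fin.castAdd m i)) / ‖(k.1 0 : ℚ_[(ν.1 : ℕ)])‖
  -- The factor K + 1 in the lower bound for ‖b₀‖ makes the radii at stage K at most η/(K+1),
  -- because every weight is at least the minimum at its place.
  have hδ : Tendsto (fun K : ℕ => η / ((K : ℝ) + 1)) atTop (𝓝 0) := by
    simpa [div_eq_mul_inv] using tendsto_one_div_add_atTop_nhds_zero_nat.const_mul η
  have hr : ∀ K, ∀ k ∈ approxFamily S f τ ε η K, ∀ ν i,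
      0 < r k ν i ∧ r k ν i ≤ η / ((K : ℝ) + 1) := by
    intro K k hk ν i
    have hpos := norm_pos_of_mem_approxFamily hk ν
    obtain ⟨h1, h2, h3, h4, h5, h6⟩ := hk
    have hH1 : (1 : ℝ) ≤ k.2 := by exact_mod_cast h3
    have hH : (0 : ℝ) < k.2 := by linarith
    refine ⟨by positivity, ?_⟩
    simp only [r]
    rw [div_le_div_iff₀ hpos (by positivity), mul_assoc]
    gcongr
    refine le_trans ?_ (h5 ν)
    rw [mul_comm]
    gcongr
    exact ciInf_le (Set.finite_range _).bddBelow _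
  filter_upwards [ae_mem_limsupBox_shrink (approxFamily S f τ ε η) (antitone_approxFamily ε η) w r
    (C / η) _ hδ hr] with x hx hxU hT hgen
  have hmem := hx fun K => ?_
  · refine mem_W_of_recurrent hτ.1 (param_mem_ZS hUZ hfZ hxU) hε fun N => ?_
    obtain ⟨k, hk, hkx⟩ := hmem N
    refine ⟨k.2, hk.2.2.2.1, k.1, hk.1, hk.2.1, hk.2.2.2.2.2 x fun ν i => ?_⟩
    exact (norm_sub_div_le_iff (norm_pos_of_mem_approxFamily hk ν)).1 (hkx ν i)
  · obtain ⟨k, hk, hkx⟩ := exists_mem_approxFamily hd hUZ hfZ hτ hτ_dom hτ_dist hη hηC hηε hprod hxU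
      hT hgen K
    refine ⟨k, hk, fun ν i => ?_⟩
    have e : C / η * r k ν i = C * (k.2 : ℝ) ^ (-τ ν.1 (Fin.castAdd m i)) /
        ‖(k.1 0 : ℚ_[(ν.1 : ℕ)])‖ := by
      simp only [r]
      field_simp
    exact ((norm_sub_div_le_iff (norm_pos_of_mem_approxFamily hk ν)).2 (hkx ν i)).trans_eq e.symm

/-- The exponent hypothesis makes almost every point generic. -/
theorem ae_isGeneric (hUZ : ∀ ν ∈ S, ∀ x ∈ U ν, ∀ i, ‖x i‖ ≤ 1)
    (hpos : ∀ ν ∈ S, (⨅ i, τ ν i) ≤ 1 → 0 < 1 - (∑ k, τ ν k) / (((d + m : ℕ) : ℝ) + 1))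
    (h : ∀ ν ∈ S, (⨅ i, τ ν i) ≤ 1 →
      manifoldExponent (S.erase ν) U f (rescale τ ν) < exponentBound τ ν) :
    ∀ᵐ x ∂haar S d, x ∈ domain S U → IsGeneric S τ (param S f x) := by
  have hν : ∀ ν : S, (⨅ i, τ ν.1 i) ≤ 1 → ∀ᵐ x ∂haar S d, x ∈ domain S U →
      ∃ ω : ℝ, 0 ≤ ω ∧
        (1 - ⨅ i, τ ν.1 i) * ω < 1 - (∑ k, τ ν.1 k) / (((d + m : ℕ) : ℝ) + 1) ∧
        exponent (S.erase ν.1) (rescale τ ν.1) (forget ν.1 (param S f x)) < ω := by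
    intro ν hle
    have hs := hpos ν.1 ν.2 hle
    obtain ⟨ω', hω', hlt⟩ := sInf_lt_iff.1 (h ν.1 ν.2 hle)
    have hb0 : (0 : EReal) < exponentBound τ ν.1 := by
      unfold exponentBound
      split_ifs with h1
      · exact_mod_cast div_pos hs (by linarith)
      · exact EReal.zero_lt_top
    -- Taking the maximum with 0 keeps ω nonnegative even when the exponent is negative or -∞; the
    -- strict gap leaves room for a real ω.
    obtain ⟨ω, hω1, hω2⟩ := EReal.lt_iff_exists_real_btwn.1 (max_lt hlt hb0)
    have hω0 : 0 ≤ ω := by exact_mod_cast ((le_max_right _ _).trans_lt hω1).le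
    have hωs : (1 - ⨅ i, τ ν.1 i) * ω < 1 - (∑ k, τ ν.1 k) / (((d + m : ℕ) : ℝ) + 1) := by
      unfold exponentBound at hω2
      split_ifs at hω2 with h1
      · have h2 := EReal.coe_lt_coe_iff.1 hω2
        rw [lt_div_iff₀ (by linarith)] at h2
        linarith
      · have : (⨅ i, τ ν.1 i) = 1 := le_antisymm hle (not_lt.1 h1)
        rw [this]
        simpa using hs
    filter_upwards [ae_forget ν hω'] with x hx hxU
    refine ⟨ω, hω0, hωs, lt_of_le_of_lt ?_ ((le_max_left _ _).trans_lt hω1)⟩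
    exact hx (fun σ i => hUZ σ.1 σ.2 _ (hxU σ) i) fun σ =>
      hxU ⟨σ.1, Finset.mem_of_mem_erase σ.2⟩
  have hall : ∀ᵐ x ∂haar S d, ∀ ν : S, (⨅ i, τ ν.1 i) ≤ 1 → x ∈ domain S U → ∃ ω : ℝ, 0 ≤ ω ∧
        (1 - ⨅ i, τ ν.1 i) * ω < 1 - (∑ k, τ ν.1 k) / (((d + m : ℕ) : ℝ) + 1) ∧
        exponent (S.erase ν.1) (rescale τ ν.1) (forget ν.1 (param S f x)) < ω := by
    rw [ae_all_iff]
    intro ν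
    by_cases hle : (⨅ i, τ ν.1 i) ≤ 1
    · filter_upwards [hν ν hle] with x hx _ using hx
    · exact Eventually.of_forall fun x h => absurd h hle
  filter_upwards [hall] with x hx hxU ν hle using hx ν hle hxU

/-- The exceptional null sets for the various ℓ and Taylor constants M are countable in number. -/
theorem haar_param_mem_Bad_eq_zero (hd : 1 ≤ d) (hU : ∀ ν ∈ S, IsOpen (U ν))
    (hUZ : ∀ ν ∈ S, ∀ x ∈ U ν, ∀ i, ‖x i‖ ≤ 1) (hfZ : ∀ ν ∈ S, ∀ x ∈ U ν, ∀ j, ‖f ν x j‖ ≤ 1)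
    (hf : ∀ ν ∈ S, IsC2On ℚ_[(ν : ℕ)] (f ν) (U ν)) (hτ : IsWeight S τ)
    (hτ_dom : ∀ ν ∈ S, ∀ (i : Fin d) (j : Fin m), τ ν (Fin.natAdd d j) ≤ τ ν (Fin.castAdd m i))
    (hτ_dist : ∀ ν ∈ S, ∀ j, (∑ i, τ ν i) / (((d + m : ℕ) : ℝ) + 1) < τ ν j)
    (hpos : ∀ ν ∈ S, (⨅ i, τ ν i) ≤ 1 → 0 < 1 - (∑ k, τ ν k) / (((d + m : ℕ) : ℝ) + 1))
    (h : ∀ ν ∈ S, (⨅ i, τ ν i) ≤ 1 →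
      manifoldExponent (S.erase ν) U f (rescale τ ν) < exponentBound τ ν) :
    haar S d {x | x ∈ domain S U ∧ param S f x ∈ Bad S τ} = 0 := by
  have hW : ∀ᵐ x ∂haar S d, ∀ ℓ M : ℕ, x ∈ domain S U → HasTaylor S U f ((M : ℝ) + 1) x →
      IsGeneric S τ (param S f x) → param S f x ∈ W S τ (1 / ((ℓ : ℝ) + 1)) := by
    simp only [ae_all_iff]
    exact fun ℓ M => ae_param_mem_W hd hUZ hfZ hτ hτ_dom hτ_dist (by positivity) M
  refine measure_mono_null ?_ (ae_iff.1 (hW.and (ae_isGeneric hUZ hpos h)))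
  rintro x ⟨hxU, hxB⟩ ⟨h1, h2⟩
  obtain ⟨M, hM⟩ := exists_hasTaylor hU hf hxU
  exact hxB.2 (Set.mem_iInter.2 fun ℓ => h1 ℓ M hxU hM (h2 hxU))

end Main

end

end SArith

theorem theorem8p6 (S : Finset Nat.Primes) (d m : ℕ) (hd : 1 ≤ d)
    (U : ∀ ν : Nat.Primes, Set (Fin d → ℚ_[(ν : ℕ)]))
    (f : ∀ ν : Nat.Primes, (Fin d → ℚ_[(ν : ℕ)]) → (Fin m → ℚ_[(ν : ℕ)]))
    (hU : ∀ ν ∈ S, IsOpen (U ν))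
    (hUZ : ∀ ν ∈ S, ∀ x ∈ U ν, ∀ i, ‖x i‖ ≤ 1)
    (hfZ : ∀ ν ∈ S, ∀ x ∈ U ν, ∀ j, ‖f ν x j‖ ≤ 1)
    (hf : ∀ ν ∈ S, SArith.IsC2On ℚ_[(ν : ℕ)] (f ν) (U ν))
    (τ : Nat.Primes → Fin (d + m) → ℝ)
    (hτ : SArith.IsWeight S τ)
    (hτ_dom : ∀ ν ∈ S, ∀ (i : Fin d) (j : Fin m), τ ν (Fin.natAdd d j) ≤ τ ν (Fin.castAdd m i))
    (hτ_dist : ∀ ν ∈ S, ∀ j, 1 / (((d + m : ℕ) : ℝ) + 1) * ∑ i, τ ν i < τ ν j) :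
    ((∀ ν ∈ S, (⨅ i, τ ν i) ≤ 1 →
        SArith.manifoldExponent (S.erase ν) U f (SArith.rescale τ ν) <
          SArith.exponentBound τ ν) →
      SArith.haar S d {x | x ∈ SArith.domain S U ∧ SArith.param S f x ∈ SArith.Bad S τ} = 0) ∧
    ((∀ ν ∈ S, (⨅ i, τ ν i) ≤ 1 → SArith.StronglyExtremal (S.erase ν) U f) →
      SArith.haar S d {x | x ∈ SArith.domain S U ∧ SArith.param S f x ∈ SArith.Bad S τ} = 0) := by
  have hdist : ∀ ν ∈ S, ∀ j, (∑ i, τ ν i) / (((d + m : ℕ) : ℝ) + 1) < τ ν j := by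
    intro ν hν j
    have := hτ_dist ν hν j
    rwa [one_div_mul_eq_div] at this
  have : Nonempty (Fin (d + m)) := ⟨⟨0, by omega⟩⟩
  have hmin : ∀ ν ∈ S, (∑ k, τ ν k) / (((d + m : ℕ) : ℝ) + 1) < ⨅ i, τ ν i := by
    intro ν hν
    obtain ⟨i, hi⟩ := exists_eq_ciInf_of_finite (f := fun i => τ ν i)
    exact hi ▸ hdist ν hν i
  have hpos : ∀ ν ∈ S, (⨅ i, τ ν i) ≤ 1 →
      0 < 1 - (∑ k, τ ν k) / (((d + m : ℕ) : ℝ) + 1) := fun ν hν h => by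
    linarith [hmin ν hν]
  have h1 := SArith.haar_param_mem_Bad_eq_zero (f := f) hd hU hUZ hfZ hf hτ hτ_dom hdist hpos
  refine ⟨h1, fun h => h1 fun ν hν hle => ?_⟩
  obtain ⟨hw, hadm⟩ := SArith.rescale_admissible hτ hdist hν (hpos ν hν hle)
  rw [h ν hν hle _ hw hadm]
  unfold SArith.exponentBound
  split_ifs with hlt
  · have : (1 : ℝ) < (1 - (∑ i, τ ν i) / (((d + m : ℕ) : ℝ) + 1)) / (1 - ⨅ i, τ ν i) := by
      rw [one_lt_div (by linarith)]
      linarith [hmin ν hν]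
    exact_mod_cast this
  · exact EReal.coe_lt_top 1
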